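/- Let $m\ge 1$ and let ${\bf p}=(p_1,\dots,p_m)$ be a probability vector with all $p_i>0$; let $\mathcal I=\{1,\dots,m\}^{\mathbb N}$ carry the Bernoulli measure determined by ${\bf p}$. For each $i\in\{1,\dots,m\}$ let $m_i\ge1$, and $m_{ij}\ge 1$ for $1\le j\le m_i$, be integers, let $\mathcal J_i=\{(j,k):1\le j\le m_i,\ 1\le k\le m_{ij}\}$, and for $(j,k)\in\mathcal J_i$ let $$A_{ijk}(x,y)=(a_{ijk}x+c_{ijk},\ b_{ij}y+d_{ij}),$$ where $0<a_{ijk}\le b_{ij}<1$, $\sum_j b_{ij}\le 1$, $\sum_k a_{ijk}\le 1$, $0\le d_{i1}<\dots<d_{im_i}<1$ with $d_{i(j+1)}-d_{ij}\ge b_{ij}$ and $1-d_{im_i}\ge b_{im_i}$, and $0\le c_{ij1}<\dots<c_{ijm_{ij}}<1$ with $c_{ij(k+1)}-c_{ijk}\ge a_{ijk}$ and $1-c_{ijm_{ij}}\ge a_{ijm_{ij}}$. For ${\bf i}=(i_1,i_2,\dots)\in\mathcal I$ the random self-affine Sierpiński carpet is $$\Lambda_{\bf i}=\bigcap_{n=1}^\infty\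 \bigcup_{(j_1,k_1)\in\mathcal J_{i_1},\dots,(j_n,k_n)\in\mathcal J_{i_n}} A_{i_1j_1k_1}\circ\cdots\circ A_{i_nj_nk_n}([0,1]^2).$$ Consider the following hypotheses. (1) For each $t\in[0,1]$ there exist $1\le i\le m$ and $1\le j<j'\le m_i$ such that $\sum_k a_{ijk}^t\ne\sum_k a_{ij'k}^t$. (2) For each $i$ there are numbers $0<a_i\le b_i<1$ such that $(1+\varepsilon)^{-1}<b_{ij}/b_i<1+\varepsilon$ and $(1+\varepsilon)^{-1}<a_{ijk}/a_i<1+\varepsilon$ for all $(j,k)\in\mathcal J_i$. (3) For each $i$, $b_{ij}/a_{ijk}<1+\varepsilon$ for all $(j,k)\in\mathcal J_i$. **Theorem A.** There exists $\varepsilon>0$ such that, for all data as above satisfying (1) and at least one of (2), (3) with this $\varepsilon$, the following holds. For every collection ${\bf P}=(p_{ij})_{1\le i\le m,\,1\le j\le m_i}$ of non-negative numbers with $\sum_{j=1}^{m_i}p_{ij}=p_i$ for all $i$ there is a unique $t({\bf P})\in[0,1]$ with $\sum_{i,j}p_{ij}\log\bigl(\sum_k a_{ijk}^{t({\bf P})}\bigr)=0$.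 Put, with the convention $0\log 0=0$, $$\lambda({\bf P})=\frac{\sum_{i,j}p_{ij}\log p_{ij}-\sum_i p_i\log p_i}{\sum_{i,j}p_{ij}\log b_{ij}}.$$ Then the supremum below is finite, and for almost every ${\bf i}\in\mathcal I$ the Hausdorff dimension of $\Lambda_{\bf i}$ is $$\dim_H\Lambda_{\bf i}=\sup_{\bf P}\{\lambda({\bf P})+t({\bf P})\},$$ the supremum being over all collections ${\bf P}$ as above. -/

import Mathlib

open MeasureTheory

noncomputable section

/-- The data of `m` self-affine Sierpinski carpets, indexed by `i : Fin m`. The `i`-th one has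
`rows i` rows; row `j` has height `b i j`, lower edge at height `d i j`, and contains
`cols i j` rectangles, the `k`-th of which has width `a i j k` and left edge at `c i j k`.
All indices start at `0`. -/
structure CarpetFamily (m : ℕ) where
  rows : Fin m → ℕ
  cols : (i : Fin m) → Fin (rows i) → ℕ
  a : (i : Fin m) → (j : Fin (rows i)) → Fin (cols i j) → ℝ
  b : (i : Fin m) → Fin (rows i) → ℝ
  c : (i : Fin m) → (j : Fin (rows i)) → Fin (cols i j) → ℝ
  d : (i : Fin m) → Fin (rows i) → ℝ
  rows_pos : ∀ i, 1 ≤ rows i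
  cols_pos : ∀ i j, 1 ≤ cols i j
  a_pos : ∀ i j k, 0 < a i j k
  a_le_b : ∀ i j k, a i j k ≤ b i j
  b_lt_one : ∀ i j, b i j < 1
  sum_b_le : ∀ i, ∑ j, b i j ≤ 1
  sum_a_le : ∀ i j, ∑ k, a i j k ≤ 1
  d_nonneg : ∀ i j, 0 ≤ d i j
  d_strictMono : ∀ i, StrictMono (d i)
  d_lt_one : ∀ i j, d i j < 1
  d_gap : ∀ i (j j' : Fin (rows i)), (j : ℕ) + 1 = j' → b i j ≤ d i j' - d i j
  d_last : ∀ i (j : Fin (rows i)), (j : ℕ) + 1 = rows i → b i j ≤ 1 - d i j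
  c_nonneg : ∀ i j k, 0 ≤ c i j k
  c_strictMono : ∀ i j, StrictMono (c i j)
  c_lt_one : ∀ i j k, c i j k < 1
  c_gap : ∀ i j (k k' : Fin (cols i j)), (k : ℕ) + 1 = k' → a i j k ≤ c i j k' - c i j k
  c_last : ∀ i j (k : Fin (cols i j)), (k : ℕ) + 1 = cols i j → a i j k ≤ 1 - c i j k

/-- The unit square `[0,1]²` of the Euclidean plane. -/
def unitSquare : Set (EuclideanSpace ℝ (Fin 2)) :=
  {x | ∀ s, x s ∈ Set.Icc (0 : ℝ) 1}

namespace CarpetFamily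

variable {m : ℕ} (D : CarpetFamily m)

/-- The index set `𝒥_i` of pairs `(j, k)`. -/
abbrev Index (i : Fin m) : Type := (j : Fin (D.rows i)) × Fin (D.cols i j)

/-- The map `A_{ijk}`: `(x, y) ↦ (a_{ijk} x + c_{ijk}, b_{ij} y + d_{ij})`. -/
def affineMap (i : Fin m) (w : D.Index i) (x : EuclideanSpace ℝ (Fin 2)) :
    EuclideanSpace ℝ (Fin 2) :=
  !₂[D.a i w.1 w.2 * x 0 + D.c i w.1 w.2, D.b i w.1 * x 1 + D.d i w.1]

/-- The composition `A_{i_1 w_1} ∘ ⋯ ∘ A_{i_n w_n}`. -/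
def wordMap (i : ℕ → Fin m) (n : ℕ) (w : (l : Fin n) → D.Index (i l)) :
    EuclideanSpace ℝ (Fin 2) → EuclideanSpace ℝ (Fin 2) :=
  (List.ofFn fun l : Fin n => D.affineMap (i l) (w l)).foldr (fun f g => f ∘ g) id

/-- The random carpet `Λ_i` of the sequence `i`. -/
def carpet (i : ℕ → Fin m) : Set (EuclideanSpace ℝ (Fin 2)) :=
  ⋂ (n : ℕ) (_ : 1 ≤ n), ⋃ w : (l : Fin n) → D.Index (i l), D.wordMap i n w '' unitSquare

/-- `∑_k a_{ijk}^t`. -/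
def rowSum (t : ℝ) (i : Fin m) (j : Fin (D.rows i)) : ℝ := ∑ k, D.a i j k ^ t

/-- The generic hypothesis. -/
def Generic : Prop :=
  ∀ t ∈ Set.Icc (0 : ℝ) 1, ∃ (i : Fin m) (j j' : Fin (D.rows i)),
    j < j' ∧ D.rowSum t i j ≠ D.rowSum t i j'

/-- First robust hypothesis: within each carpet, all heights are comparable up to `1 + ε`,
and so are all widths. -/
def NearlyUniform (ε : ℝ) : Prop :=
  ∀ i : Fin m, ∃ a₀ b₀ : ℝ, 0 < a₀ ∧ a₀ ≤ b₀ ∧ b₀ < 1 ∧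
    ∀ (j : Fin (D.rows i)) (k : Fin (D.cols i j)),
      ((1 + ε)⁻¹ < D.b i j / b₀ ∧ D.b i j / b₀ < 1 + ε) ∧
      ((1 + ε)⁻¹ < D.a i j k / a₀ ∧ D.a i j k / a₀ < 1 + ε)

/-- Second robust hypothesis: all the maps are nearly conformal. -/
def NearlyConformal (ε : ℝ) : Prop :=
  ∀ (i : Fin m) (j : Fin (D.rows i)) (k : Fin (D.cols i j)), D.b i j / D.a i j k < 1 + ε

/-- The collections `P = (p_{ij})` of non-negative numbers with `∑_j p_{ij} = p_i`. -/
def Admissible (p : Fin m → ℝ) (P : (i : Fin m) → Fin (D.rows i) → ℝ) : Prop :=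
  (∀ i j, 0 ≤ P i j) ∧ ∀ i, ∑ j, P i j = p i

/-- The number `λ(P)`; `Real.log 0 = 0` gives the convention `0 log 0 = 0`. -/
def baseDim (p : Fin m → ℝ) (P : (i : Fin m) → Fin (D.rows i) → ℝ) : ℝ :=
  ((∑ i, ∑ j, P i j * Real.log (P i j)) - ∑ i, p i * Real.log (p i)) /
    ∑ i, ∑ j, P i j * Real.log (D.b i j)

/-- `t = t(P)`: the number `t` lies in `[0,1]` and `∑_{i,j} p_{ij} log ∑_k a_{ijk}^t = 0`. -/
def IsFiberDim (P : (i : Fin m) → Fin (D.rows i) → ℝ) (t : ℝ) : Prop :=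
  t ∈ Set.Icc (0 : ℝ) 1 ∧ ∑ i, ∑ j, P i j * Real.log (D.rowSum t i j) = 0

/-- The set of the numbers `λ(P) + t(P)`, over all admissible `P`. -/
def dimValues (p : Fin m → ℝ) : Set ℝ :=
  {x | ∃ (P : (i : Fin m) → Fin (D.rows i) → ℝ) (t : ℝ),
    D.Admissible p P ∧ D.IsFiberDim P t ∧ x = D.baseDim p P + t}

end CarpetFamily

/-- The Bernoulli measure on `{1, …, m}^ℕ` with one-step weights `p`. -/
def bernoulliMeasure {m : ℕ} (p : Fin m → ℝ) : Measure (ℕ → Fin m) :=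
  Measure.infinitePi fun _ : ℕ => ∑ i : Fin m, ENNReal.ofReal (p i) • Measure.dirac i

end

noncomputable section

open Filter Topology Set

/-! Since widths never exceed heights, the natural covering sets are approximate squares: a word is
followed through its first `L` letters, which fixes the horizontal interval, and then only through
its rows up to a larger level `n`, where the height has dropped to about the width at level `L`.
Randomness of `i` enters only through letter frequencies, which converge to `p` almost surely; the
rest is proved for each such `i`.

Lower bound (`le_dimH_planeCarpet`). Given `P` and `t = t(P)`, choose rows independently with
conditional law `P i j / p i` and columns with probability proportional to `a ^ t`. By the law of
large numbers, an approximate square of side `r` has mass at most about `r ^ (λ(P) + t)`: the rows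
contribute `r ^ λ(P)`, the columns `r ^ t`, and the row-sum denominators nearly cancel because `t`
is the zero of the pressure. An area count shows that a set of diameter `r` meets boundedly many
such squares, so the mass distribution principle applies.

Upper bound (`dimH_planeCarpet_le`). Let `δ` bound all values `λ(P) + t(P)`. Each approximate square
is weighted by the product measure built from its own empirical row counts: counts up to `n` for the
rows, and the fiber dimension of the counts up to `L` for the columns. There are polynomially many
count arrays, so the total weight at level `n` is polynomial (`sum_totalWeight_le`). The variational
bound concerns a single array, whereas two arrays occur here. The fiber dimension lies in `[0, 1]`,
so it cannot drop by `ε` at every passage from `L` to the matching `n`; hence every word has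
arbitrarily deep levels at which the mismatch is harmless (`exists_good_level`). There the weight is
at least about `wid ^ (δ + 2ε)`, and one further `ε` makes the sum over levels converge. -/

instance Sigma.instDiscreteMeasurableSpace {α : Type*} {β : α → Type*}
    [∀ a, MeasurableSpace (β a)] [∀ a, DiscreteMeasurableSpace (β a)] :
    DiscreteMeasurableSpace (Sigma β) := by
  refine ⟨fun s => ?_⟩
  simp only [MeasurableSpace.measurableSet_iInf]
  exact fun a => (MeasurableSet.of_discrete : MeasurableSet (Sigma.mk a ⁻¹' s))

/-! ### Compositions of affine contractions of an interval, and stopping levels. -/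

/-- The ratio of the composition of the first `n` maps `x ↦ α l * x + γ l`. -/
def scaleProd (α : ℕ → ℝ) (n : ℕ) : ℝ := ∏ l ∈ Finset.range n, α l

/-- The image of `0` under the composition of the first `n` maps `x ↦ α l * x + γ l`. -/
def offset (α γ : ℕ → ℝ) (n : ℕ) : ℝ := ∑ l ∈ Finset.range n, γ l * scaleProd α l

lemma scaleProd_zero (α : ℕ → ℝ) : scaleProd α 0 = 1 := by simp [scaleProd]

lemma scaleProd_succ (α : ℕ → ℝ) (n : ℕ) : scaleProd α (n + 1) = scaleProd α n * α n := by
  simp [scaleProd, Finset.prod_range_succ]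

lemma offset_zero (α γ : ℕ → ℝ) : offset α γ 0 = 0 := by simp [offset]

lemma offset_succ (α γ : ℕ → ℝ) (n : ℕ) :
    offset α γ (n + 1) = offset α γ n + γ n * scaleProd α n := by
  simp [offset, Finset.sum_range_succ]

lemma scaleProd_pos {α : ℕ → ℝ} (h : ∀ l, 0 < α l) (n : ℕ) : 0 < scaleProd α n :=
  Finset.prod_pos fun l _ => h l

lemma scaleProd_antitone {α : ℕ → ℝ} (h : ∀ l, 0 < α l) (h1 : ∀ l, α l < 1) :
    Antitone (scaleProd α) := by
  refine antitone_nat_of_succ_le fun n => ?_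
  rw [scaleProd_succ]
  exact mul_le_of_le_one_right (scaleProd_pos h n).le (h1 n).le

lemma scaleProd_le_pow {α : ℕ → ℝ} (h : ∀ l, 0 < α l) {B : ℝ} (hB : ∀ l, α l ≤ B) (n : ℕ) :
    scaleProd α n ≤ B ^ n := by
  refine (Finset.prod_le_prod (fun l _ => (h l).le) (fun l _ => hB l)).trans ?_
  simp

lemma pow_le_scaleProd {α : ℕ → ℝ} {B : ℝ} (hB0 : 0 ≤ B) (hB : ∀ l, B ≤ α l) (n : ℕ) :
    B ^ n ≤ scaleProd α n := by
  refine le_trans ?_ (Finset.prod_le_prod (fun l _ => hB0) (fun l _ => hB l))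
  simp

lemma scaleProd_congr {α α' : ℕ → ℝ} {n : ℕ} (h : ∀ l < n, α l = α' l) :
    scaleProd α n = scaleProd α' n :=
  Finset.prod_congr rfl fun l hl => h l (Finset.mem_range.1 hl)

lemma offset_congr {α α' γ γ' : ℕ → ℝ} {n : ℕ} (h : ∀ l < n, α l = α' l)
    (h' : ∀ l < n, γ l = γ' l) : offset α γ n = offset α' γ' n :=
  Finset.sum_congr rfl fun l hl => by
    rw [h' l (Finset.mem_range.1 hl),
      scaleProd_congr fun k hk => h k (hk.trans (Finset.mem_range.1 hl))]

lemma offset_monotone {α γ : ℕ → ℝ} (h : ∀ l, 0 < α l) (h0 : ∀ l, 0 ≤ γ l) :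
    Monotone (offset α γ) := by
  refine monotone_nat_of_le_succ fun n => ?_
  rw [offset_succ]
  nlinarith [mul_nonneg (h0 n) (scaleProd_pos h n).le]

lemma offset_add_antitone {α γ : ℕ → ℝ} (h : ∀ l, 0 < α l) (h1 : ∀ l, γ l + α l ≤ 1) :
    Antitone fun n => offset α γ n + scaleProd α n := by
  refine antitone_nat_of_succ_le fun n => ?_
  simp only [offset_succ, scaleProd_succ]
  nlinarith [mul_nonneg (sub_nonneg.2 (h1 n)) (scaleProd_pos h n).le]

/-- Intervals whose codings first differ at the index `l` are separated. -/
lemma offset_separated {α γ α' γ' : ℕ → ℝ} (h : ∀ l, 0 < α l) (h0 : ∀ l, 0 ≤ γ' l)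
    (h1 : ∀ l, γ l + α l ≤ 1) (h' : ∀ l, 0 < α' l) {l n n' : ℕ}
    (hα : ∀ k < l, α k = α' k) (hγ : ∀ k < l, γ k = γ' k) (hl : γ l + α l ≤ γ' l)
    (hn : l < n) (hn' : l < n') :
    offset α γ n + scaleProd α n ≤ offset α' γ' n' := by
  have e1 : offset α γ n + scaleProd α n ≤ offset α γ (l + 1) + scaleProd α (l + 1) :=
    offset_add_antitone h h1 hn
  have e2 : offset α' γ' (l + 1) ≤ offset α' γ' n' := offset_monotone h' h0 hn'
  rw [offset_succ, scaleProd_succ] at e1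
  rw [offset_succ, ← offset_congr hα hγ, ← scaleProd_congr hα] at e2
  nlinarith [mul_nonneg (sub_nonneg.2 hl) (scaleProd_pos h l).le]

/-- The common point of the nested intervals. -/
def limitPoint (α γ : ℕ → ℝ) : ℝ := ⨆ n, offset α γ n

lemma limitPoint_mem {α γ : ℕ → ℝ} (h : ∀ l, 0 < α l) (h0 : ∀ l, 0 ≤ γ l)
    (h1 : ∀ l, γ l + α l ≤ 1) (n : ℕ) :
    limitPoint α γ ∈ Icc (offset α γ n) (offset α γ n + scaleProd α n) := by
  have key : ∀ n k, offset α γ k ≤ offset α γ n + scaleProd α n := fun n k => by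
    have h2 := offset_monotone h h0 (le_max_right n k)
    have h3 := offset_add_antitone h h1 (le_max_left n k)
    have h4 := scaleProd_pos h (max n k)
    simp only at h3
    linarith
  refine ⟨le_ciSup (f := offset α γ) ⟨1, ?_⟩ n, ciSup_le (key n)⟩
  rintro _ ⟨k, rfl⟩
  simpa [offset_zero, scaleProd_zero] using key 0 k

/-- The first index at which the sequence `f` is at most `r`. -/
def firstLE (f : ℕ → ℝ) (r : ℝ) : ℕ := sInf {n | f n ≤ r}

lemma firstLE_spec {f : ℕ → ℝ} {r : ℝ} (h : ∃ n, f n ≤ r) : f (firstLE f r) ≤ r :=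
  Nat.sInf_mem (s := {n | f n ≤ r}) h

lemma lt_of_lt_firstLE {f : ℕ → ℝ} {r : ℝ} {n : ℕ} (h : n < firstLE f r) : r < f n :=
  not_le.1 fun h' => Nat.notMem_of_lt_sInf h h'

lemma firstLE_le {f : ℕ → ℝ} {r : ℝ} {n : ℕ} (h : f n ≤ r) : firstLE f r ≤ n :=
  Nat.sInf_le h

/-- Stopping-time property: agreement up to the earlier of the two times already forces the times to
coincide. -/
lemma firstLE_congr {f g : ℕ → ℝ} {r : ℝ} (hf : ∃ n, f n ≤ r) (hg : ∃ n, g n ≤ r)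
    (h : ∀ n ≤ min (firstLE f r) (firstLE g r), f n = g n) : firstLE f r = firstLE g r := by
  rcases le_total (firstLE f r) (firstLE g r) with h' | h'
  · refine le_antisymm h' (firstLE_le ?_)
    rw [← h _ (by simp [h'])]
    exact firstLE_spec hf
  · refine le_antisymm (firstLE_le ?_) h'
    rw [h _ (by simp [h'])]
    exact firstLE_spec hg

lemma exists_scaleProd_le {α : ℕ → ℝ} (h : ∀ l, 0 < α l) {B : ℝ} (hB1 : B < 1)
    (hB : ∀ l, α l ≤ B) {r : ℝ} (hr : 0 < r) : ∃ n, scaleProd α n ≤ r := by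
  have hB0 : 0 < B := (h 0).trans_le (hB 0)
  obtain ⟨n, hn⟩ := exists_pow_lt_of_lt_one hr hB1
  exact ⟨n, (scaleProd_le_pow h hB n).trans hn.le⟩

/-- Just before stopping the product exceeds `r`, and a single factor is at least `b`, so the
overshoot is bounded. -/
lemma mul_le_scaleProd_firstLE {α : ℕ → ℝ} {b : ℝ} (hb0 : 0 < b)
    (hb1 : b ≤ 1) (hb : ∀ l, b ≤ α l) {r : ℝ} (hr : 0 < r) (hr1 : r ≤ 1) :
    b * r ≤ scaleProd α (firstLE (scaleProd α) r) := by
  rcases Nat.eq_zero_or_pos (firstLE (scaleProd α) r) with h0 | h0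
  · rw [h0, scaleProd_zero]
    nlinarith
  · obtain ⟨k, hk⟩ := Nat.exists_eq_succ_of_ne_zero h0.ne'
    have := lt_of_lt_firstLE (f := scaleProd α) (r := r) (n := k) (by omega)
    rw [hk, Nat.succ_eq_add_one, scaleProd_succ]
    nlinarith [hb k]

/-! ### Geometry of the cells of a word; the carpet as a union over infinite words. -/

namespace CarpetFamily

variable {m : ℕ} (D : CarpetFamily m)

lemma d_add_le {i : Fin m} {j j' : Fin (D.rows i)} (h : j < j') :
    D.d i j + D.b i j ≤ D.d i j' := by
  have hlt : (j : ℕ) + 1 < D.rows i := by have := j'.2; have : (j : ℕ) < j' := h; omega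
  have h1 := D.d_gap i j ⟨j + 1, hlt⟩ rfl
  have h2 : D.d i ⟨j + 1, hlt⟩ ≤ D.d i j' := (D.d_strictMono i).monotone (by
    show (j : ℕ) + 1 ≤ j'; exact h)
  linarith

lemma c_add_le {i : Fin m} {j : Fin (D.rows i)} {k k' : Fin (D.cols i j)} (h : k < k') :
    D.c i j k + D.a i j k ≤ D.c i j k' := by
  have hlt : (k : ℕ) + 1 < D.cols i j := by have := k'.2; have : (k : ℕ) < k' := h; omega
  have h1 := D.c_gap i j k ⟨k + 1, hlt⟩ rfl
  have h2 : D.c i j ⟨k + 1, hlt⟩ ≤ D.c i j k' := (D.c_strictMono i j).monotone (by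
    show (k : ℕ) + 1 ≤ k'; exact h)
  linarith

lemma d_add_b_le_one (i : Fin m) (j : Fin (D.rows i)) : D.d i j + D.b i j ≤ 1 := by
  by_cases hlt : (j : ℕ) + 1 < D.rows i
  · have := D.d_add_le (j := j) (j' := ⟨j + 1, hlt⟩) (by simp [Fin.lt_def])
    linarith [D.d_lt_one i ⟨j + 1, hlt⟩]
  · linarith [D.d_last i j (by have := j.2; omega)]

lemma c_add_a_le_one (i : Fin m) (j : Fin (D.rows i)) (k : Fin (D.cols i j)) :
    D.c i j k + D.a i j k ≤ 1 := by
  by_cases hlt : (k : ℕ) + 1 < D.cols i j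
  · have := D.c_add_le (k := k) (k' := ⟨k + 1, hlt⟩) (by simp [Fin.lt_def])
    linarith [D.c_lt_one i j ⟨k + 1, hlt⟩]
  · linarith [D.c_last i j k (by have := k.2; omega)]

lemma b_pos (i : Fin m) (j : Fin (D.rows i)) : 0 < D.b i j :=
  (D.a_pos i j ⟨0, D.cols_pos i j⟩).trans_le (D.a_le_b i j _)

/-- Infinite words over the alphabets prescribed by `i`. -/
abbrev Word (i : ℕ → Fin m) : Type := (l : ℕ) → D.Index (i l)

variable {D} {i : ℕ → Fin m}

/-- The ratios and translation parts of the letters of a word, in both coordinates. -/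
def wordA (ω : D.Word i) (l : ℕ) : ℝ := D.a (i l) (ω l).1 (ω l).2
def wordB (ω : D.Word i) (l : ℕ) : ℝ := D.b (i l) (ω l).1
def wordC (ω : D.Word i) (l : ℕ) : ℝ := D.c (i l) (ω l).1 (ω l).2
def wordD (ω : D.Word i) (l : ℕ) : ℝ := D.d (i l) (ω l).1

/-- Width, height, left and lower edge of the `n`-th rectangle of a word. -/
def wid (ω : D.Word i) : ℕ → ℝ := scaleProd (wordA ω)
def hgt (ω : D.Word i) : ℕ → ℝ := scaleProd (wordB ω)
def xpos (ω : D.Word i) : ℕ → ℝ := offset (wordA ω) (wordC ω)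
def ypos (ω : D.Word i) : ℕ → ℝ := offset (wordB ω) (wordD ω)

lemma wordA_pos (ω : D.Word i) (l : ℕ) : 0 < wordA ω l := D.a_pos _ _ _
lemma wordB_pos (ω : D.Word i) (l : ℕ) : 0 < wordB ω l := D.b_pos _ _
lemma wordA_le (ω : D.Word i) (l : ℕ) : wordA ω l ≤ wordB ω l := D.a_le_b _ _ _
lemma wordB_lt (ω : D.Word i) (l : ℕ) : wordB ω l < 1 := D.b_lt_one _ _
lemma wordA_lt (ω : D.Word i) (l : ℕ) : wordA ω l < 1 := (wordA_le ω l).trans_lt (wordB_lt ω l)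
lemma wordC_nonneg (ω : D.Word i) (l : ℕ) : 0 ≤ wordC ω l := D.c_nonneg _ _ _
lemma wordD_nonneg (ω : D.Word i) (l : ℕ) : 0 ≤ wordD ω l := D.d_nonneg _ _
lemma wordC_add (ω : D.Word i) (l : ℕ) : wordC ω l + wordA ω l ≤ 1 := D.c_add_a_le_one _ _ _
lemma wordD_add (ω : D.Word i) (l : ℕ) : wordD ω l + wordB ω l ≤ 1 := D.d_add_b_le_one _ _

lemma wid_pos (ω : D.Word i) (n : ℕ) : 0 < wid ω n := scaleProd_pos (wordA_pos ω) n
lemma hgt_pos (ω : D.Word i) (n : ℕ) : 0 < hgt ω n := scaleProd_pos (wordB_pos ω) n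

lemma wid_le_hgt (ω : D.Word i) (n : ℕ) : wid ω n ≤ hgt ω n := by
  unfold wid hgt scaleProd
  exact Finset.prod_le_prod (fun l _ => (wordA_pos ω l).le) fun l _ => wordA_le ω l

lemma foldr_comp_apply {α : Type*} (L : List (α → α)) (g : α → α) (x : α) :
    L.foldr (fun f g => f ∘ g) g x = L.foldr (fun f g => f ∘ g) id (g x) := by
  induction L with
  | nil => rfl
  | cons f L ih => simp [ih]

lemma wordMap_succ (ω : D.Word i) (n : ℕ) (x : EuclideanSpace ℝ (Fin 2)) :
    D.wordMap i (n + 1) (fun l => ω l) x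
      = D.wordMap i n (fun l => ω l) (D.affineMap (i n) (ω n) x) := by
  unfold wordMap
  rw [List.ofFn_succ_last, List.foldr_append, foldr_comp_apply]
  simp

lemma wordMap_apply (ω : D.Word i) (n : ℕ) (x : EuclideanSpace ℝ (Fin 2)) :
    D.wordMap i n (fun l => ω l) x 0 = xpos ω n + wid ω n * x 0 ∧
    D.wordMap i n (fun l => ω l) x 1 = ypos ω n + hgt ω n * x 1 := by
  induction n generalizing x with
  | zero => simp [wordMap, xpos, ypos, wid, hgt, offset_zero, scaleProd_zero]
  | succ n ih =>
    rw [wordMap_succ, (ih _).1, (ih _).2]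
    simp only [xpos, ypos, wid, hgt, offset_succ, scaleProd_succ]
    constructor <;> simp [affineMap, wordA, wordB, wordC, wordD] <;> ring

/-- The `(L, n)`-cell of a word: its first `L` letters and the rows of its first `n` letters. -/
def cell (ω : D.Word i) (L n : ℕ) : Set (ℝ × ℝ) :=
  Icc (xpos ω L) (xpos ω L + wid ω L) ×ˢ Icc (ypos ω n) (ypos ω n + hgt ω n)

lemma cell_antitone (ω : D.Word i) {L L' n n' : ℕ} (hL : L ≤ L') (hn : n ≤ n') :
    cell ω L' n' ⊆ cell ω L n := by
  refine Set.prod_mono (Icc_subset_Icc ?_ ?_) (Icc_subset_Icc ?_ ?_)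
  · exact offset_monotone (wordA_pos ω) (wordC_nonneg ω) hL
  · exact offset_add_antitone (wordA_pos ω) (wordC_add ω) hL
  · exact offset_monotone (wordB_pos ω) (wordD_nonneg ω) hn
  · exact offset_add_antitone (wordB_pos ω) (wordD_add ω) hn

lemma mem_image_wordMap (ω : D.Word i) (n : ℕ) (x : EuclideanSpace ℝ (Fin 2)) :
    x ∈ D.wordMap i n (fun l => ω l) '' unitSquare ↔ (x 0, x 1) ∈ cell ω n n := by
  have hw := wid_pos ω n
  have hh := hgt_pos ω n
  simp only [cell, Set.mem_prod, Set.mem_Icc]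
  constructor
  · rintro ⟨y, hy, rfl⟩
    have h0 := hy 0
    have h1 := hy 1
    rw [Set.mem_Icc] at h0 h1
    rw [(wordMap_apply ω n y).1, (wordMap_apply ω n y).2]
    refine ⟨⟨?_, ?_⟩, ⟨?_, ?_⟩⟩ <;> nlinarith
  · rintro ⟨⟨h1, h2⟩, ⟨h3, h4⟩⟩
    refine ⟨!₂[(x 0 - xpos ω n) / wid ω n, (x 1 - ypos ω n) / hgt ω n], ?_, ?_⟩
    · intro s
      fin_cases s
      · simp only [Fin.zero_eta, Matrix.cons_val_zero, Set.mem_Icc]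
        rw [div_le_one hw]
        exact ⟨div_nonneg (by linarith) hw.le, by linarith⟩
      · simp only [Fin.mk_one, Matrix.cons_val_one, Set.mem_Icc,
          Matrix.cons_val_fin_one]
        rw [div_le_one hh]
        exact ⟨div_nonneg (by linarith) hh.le, by linarith⟩
    · ext s
      fin_cases s
      · simp only [Fin.zero_eta]
        rw [(wordMap_apply ω n _).1]
        simp
        field_simp
        ring
      · simp only [Fin.mk_one]
        rw [(wordMap_apply ω n _).2]
        simp
        field_simp
        ring

/-- The carpet in the plane `ℝ × ℝ`. -/
def planeCarpet (D : CarpetFamily m) (i : ℕ → Fin m) : Set (ℝ × ℝ) :=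
  {z | ∃ ω : D.Word i, ∀ n, z ∈ cell ω n n}

instance (D : CarpetFamily m) (i : Fin m) : Nonempty (D.Index i) :=
  ⟨⟨⟨0, D.rows_pos i⟩, ⟨0, D.cols_pos _ _⟩⟩⟩

/-- Extension of a finite word by arbitrary letters. -/
def extendWord {n : ℕ} (w : (l : Fin n) → D.Index (i l)) : D.Word i :=
  fun l => if h : l < n then w ⟨l, h⟩ else Classical.arbitrary _

lemma extendWord_apply {n : ℕ} (w : (l : Fin n) → D.Index (i l)) (l : Fin n) :
    extendWord w l = w l := by
  simp [extendWord]

/-- The carpet provides a possibly different finite word at each level; a single infinite word comes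
from compactness of the product of finite alphabets. -/
lemma mem_carpet_iff (x : EuclideanSpace ℝ (Fin 2)) :
    x ∈ D.carpet i ↔ (x 0, x 1) ∈ planeCarpet D i := by
  constructor
  · intro hx
    simp only [carpet, Set.mem_iInter, Set.mem_iUnion] at hx
    let K : ℕ → Set (D.Word i) := fun n => {ω | (x 0, x 1) ∈ cell ω n n}
    have hK : ∀ n, K n = (fun (ω : D.Word i) (l : Fin n) => ω l) ⁻¹'
        {w | x ∈ D.wordMap i n w '' unitSquare} := by
      intro n
      ext ω
      exact (mem_image_wordMap ω n x).symm
    have hanti : ∀ n, K (n + 1) ⊆ K n := fun n ω hω =>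
      cell_antitone ω n.le_succ n.le_succ hω
    have hne' : ∀ n, 1 ≤ n → (K n).Nonempty := by
      intro n hn
      obtain ⟨w, hw⟩ := hx n hn
      refine ⟨extendWord w, ?_⟩
      rw [hK]
      simp only [Set.mem_preimage, extendWord_apply]
      exact hw
    have hne : ∀ n, (K n).Nonempty := fun n => (hne' (n + 1) (by omega)).mono (hanti n)
    have hcl : ∀ n, IsClosed (K n) := by
      intro n
      rw [hK]
      -- `K n` depends only on the first `n` letters, which range over a discrete space.
      exact (isClosed_discrete _).preimage (by fun_prop)
    obtain ⟨ω, hω⟩ := IsCompact.nonempty_iInter_of_sequence_nonempty_isCompact_isClosed K hanti hne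
      (hcl 0).isCompact hcl
    exact ⟨ω, fun n => Set.mem_iInter.1 hω n⟩
  · rintro ⟨ω, hω⟩
    simp only [carpet, Set.mem_iInter, Set.mem_iUnion]
    exact fun n _ => ⟨fun l => ω l, (mem_image_wordMap ω n x).2 (hω n)⟩

/-- Linear equivalences preserve dimension; the sup metric of `ℝ × ℝ` suits cells, which are
products of intervals. -/
lemma dimH_carpet (D : CarpetFamily m) (i : ℕ → Fin m) :
    dimH (D.carpet i) = dimH (planeCarpet D i) := by
  let e : EuclideanSpace ℝ (Fin 2) ≃L[ℝ] ℝ × ℝ :=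
    (EuclideanSpace.equiv (Fin 2) ℝ).trans (ContinuousLinearEquiv.finTwoArrow ℝ ℝ)
  rw [← e.dimH_preimage]
  congr 1
  ext x
  exact mem_carpet_iff x

end CarpetFamily

/-! ### Uniform constants, the pressure and its zero, and the variational values. -/

lemma exists_lt_bound {ι : Type*} [Finite ι] (f : ι → ℝ) {c : ℝ} (h : ∀ x, f x < c) :
    ∃ B, B < c ∧ ∀ x, f x ≤ B := by
  rcases isEmpty_or_nonempty ι with h0 | h0
  · exact ⟨c - 1, by linarith, fun x => (h0.false x).elim⟩
  · obtain ⟨x, hx⟩ := Finite.exists_max f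
    exact ⟨f x, h x, hx⟩

lemma exists_abs_bound {ι : Type*} [Finite ι] (f : ι → ℝ) : ∃ M, 0 < M ∧ ∀ x, |f x| ≤ M := by
  rcases isEmpty_or_nonempty ι with h0 | h0
  · exact ⟨1, one_pos, fun x => (h0.false x).elim⟩
  · obtain ⟨x, hx⟩ := Finite.exists_max fun x => |f x|
    exact ⟨|f x| + 1, by positivity, fun y => (hx y).trans (by linarith)⟩

namespace CarpetFamily

variable {m : ℕ} (D : CarpetFamily m)

lemma exists_b_bound : ∃ B, 0 < B ∧ B < 1 ∧ ∀ i j, D.b i j ≤ B := by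
  obtain ⟨B, hB, h⟩ := exists_lt_bound (ι := Σ i, Fin (D.rows i)) (fun x => D.b x.1 x.2)
    (c := 1) fun x => D.b_lt_one _ _
  exact ⟨max B (1 / 2), by positivity, by simp [hB]; norm_num,
    fun i j => (h ⟨i, j⟩).trans (le_max_left _ _)⟩

lemma exists_a_bound : ∃ a₀, 0 < a₀ ∧ a₀ ≤ 1 ∧ ∀ i j k, a₀ ≤ D.a i j k := by
  obtain ⟨B, hB, h⟩ := exists_lt_bound (ι := Σ i, D.Index i) (fun x => -D.a x.1 x.2.1 x.2.2)
    (c := 0) fun x => by have := D.a_pos x.1 x.2.1 x.2.2; linarith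
  exact ⟨min (-B) 1, by simp [hB], min_le_right _ _, fun i j k => (min_le_left _ _).trans
    (by linarith [h ⟨i, ⟨j, k⟩⟩])⟩

lemma rowSum_pos (t : ℝ) (i : Fin m) (j : Fin (D.rows i)) : 0 < D.rowSum t i j :=
  Finset.sum_pos (fun k _ => Real.rpow_pos_of_pos (D.a_pos i j k) t)
    ⟨⟨0, D.cols_pos i j⟩, Finset.mem_univ _⟩

lemma one_le_rowSum_zero (i : Fin m) (j : Fin (D.rows i)) : 1 ≤ D.rowSum 0 i j := by
  simp only [rowSum, Real.rpow_zero, Finset.sum_const, Finset.card_univ, Fintype.card_fin,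
    nsmul_eq_mul, mul_one]
  exact_mod_cast D.cols_pos i j

lemma rowSum_one_le (i : Fin m) (j : Fin (D.rows i)) : D.rowSum 1 i j ≤ 1 := by
  simpa [rowSum] using D.sum_a_le i j

lemma continuous_log_rowSum (i : Fin m) (j : Fin (D.rows i)) :
    Continuous fun t => Real.log (D.rowSum t i j) := by
  refine Continuous.log ?_ fun t => (D.rowSum_pos t i j).ne'
  unfold rowSum
  exact continuous_finsetSum _ fun k _ => Real.continuous_const_rpow (D.a_pos i j k).ne'

/-- Every ratio is at most `B`, so raising the exponent by `u - v` multiplies each summand by at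
most `B ^ (u - v)`. This uniform negative slope gives uniqueness and stability of the zero of the
pressure. -/
lemma log_rowSum_le {B : ℝ} (hB0 : 0 < B) (hB : ∀ i j, D.b i j ≤ B) {u v : ℝ} (h : v ≤ u)
    (i : Fin m) (j : Fin (D.rows i)) :
    Real.log (D.rowSum u i j) ≤ Real.log (D.rowSum v i j) + (u - v) * Real.log B := by
  have h1 : D.rowSum u i j ≤ D.rowSum v i j * B ^ (u - v) := by
    unfold rowSum
    rw [Finset.sum_mul]
    refine Finset.sum_le_sum fun k _ => ?_
    have : u = v + (u - v) := by ring
    conv_lhs => rw [this, Real.rpow_add (D.a_pos i j k)]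
    exact mul_le_mul_of_nonneg_left (Real.rpow_le_rpow (D.a_pos i j k).le
      ((D.a_le_b i j k).trans (hB i j)) (by linarith)) (Real.rpow_nonneg (D.a_pos i j k).le _)
  refine (Real.log_le_log (D.rowSum_pos _ _ _) h1).trans_eq ?_
  rw [Real.log_mul (D.rowSum_pos _ _ _).ne' (Real.rpow_pos_of_pos hB0 _).ne', Real.log_rpow hB0]

lemma exists_log_rowSum_bound :
    ∃ M, 0 < M ∧ ∀ t ∈ Icc (0 : ℝ) 1, ∀ i j, |Real.log (D.rowSum t i j)| ≤ M := by
  obtain ⟨B, hB0, hB1, hB⟩ := D.exists_b_bound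
  have hlog : Real.log B < 0 := Real.log_neg hB0 hB1
  obtain ⟨M₀, h0, hM₀⟩ := exists_abs_bound (ι := Σ i, Fin (D.rows i))
    fun x => Real.log (D.rowSum 0 x.1 x.2)
  obtain ⟨M₁, h1, hM₁⟩ := exists_abs_bound (ι := Σ i, Fin (D.rows i))
    fun x => Real.log (D.rowSum 1 x.1 x.2)
  refine ⟨M₀ + M₁, by linarith, fun t ht i j => ?_⟩
  have e0 := abs_le.1 (hM₀ ⟨i, j⟩)
  have e1 := abs_le.1 (hM₁ ⟨i, j⟩)
  have e2 := D.log_rowSum_le hB0 hB ht.1 i j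
  have e3 := D.log_rowSum_le hB0 hB ht.2 i j
  have e4 := mul_nonneg (sub_nonneg.2 ht.1) (neg_nonneg.2 hlog.le)
  have e5 := mul_nonneg (sub_nonneg.2 ht.2) (neg_nonneg.2 hlog.le)
  simp only at e0 e1
  rw [abs_le]
  constructor <;> nlinarith

/-- The function of `t` whose zero is the fiber dimension. -/
def pressure (N : (i : Fin m) → Fin (D.rows i) → ℝ) (t : ℝ) : ℝ :=
  ∑ i, ∑ j, N i j * Real.log (D.rowSum t i j)

variable {D}

lemma pressure_le {N : (i : Fin m) → Fin (D.rows i) → ℝ} (hN : ∀ i j, 0 ≤ N i j) {B : ℝ}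
    (hB0 : 0 < B) (hB : ∀ i j, D.b i j ≤ B) {u v : ℝ} (h : v ≤ u) :
    D.pressure N u ≤ D.pressure N v + (u - v) * Real.log B * ∑ i, ∑ j, N i j := by
  simp only [pressure, Finset.mul_sum, ← Finset.sum_add_distrib]
  refine Finset.sum_le_sum fun i _ => Finset.sum_le_sum fun j _ => ?_
  have := mul_le_mul_of_nonneg_left (D.log_rowSum_le hB0 hB h i j) (hN i j)
  linarith

/-- Intermediate value theorem: at `t = 0` the row sums are numbers of columns, at least `1`; at `t
= 1` they are total widths, at most `1`. -/
lemma exists_pressure_eq_zero {N : (i : Fin m) → Fin (D.rows i) → ℝ} (hN : ∀ i j, 0 ≤ N i j) :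
    ∃ t ∈ Icc (0 : ℝ) 1, D.pressure N t = 0 := by
  have hc : Continuous (D.pressure N) := continuous_finsetSum _ fun i _ =>
    continuous_finsetSum _ fun j _ => continuous_const.mul (D.continuous_log_rowSum i j)
  have h0 : 0 ≤ D.pressure N 0 := Finset.sum_nonneg fun i _ => Finset.sum_nonneg fun j _ =>
    mul_nonneg (hN i j) (Real.log_nonneg (D.one_le_rowSum_zero i j))
  have h1 : D.pressure N 1 ≤ 0 := Finset.sum_nonpos fun i _ => Finset.sum_nonpos fun j _ =>
    mul_nonpos_of_nonneg_of_nonpos (hN i j)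
      (Real.log_nonpos (D.rowSum_pos _ _ _).le (D.rowSum_one_le i j))
  obtain ⟨t, ht, h⟩ := intermediate_value_Icc' zero_le_one hc.continuousOn ⟨h1, h0⟩
  exact ⟨t, ht, h⟩

lemma existsUnique_isFiberDim {P : (i : Fin m) → Fin (D.rows i) → ℝ} (hP : ∀ i j, 0 ≤ P i j)
    (hP1 : 0 < ∑ i, ∑ j, P i j) : ∃! t, D.IsFiberDim P t := by
  obtain ⟨B, hB0, hB1, hB⟩ := D.exists_b_bound
  have hlog : Real.log B < 0 := Real.log_neg hB0 hB1
  have key : ∀ s t, D.pressure P s = 0 → D.pressure P t = 0 → s ≤ t := by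
    intro s t hs ht
    by_contra! hlt
    have := pressure_le hP hB0 hB hlt.le
    rw [hs, ht] at this
    nlinarith [mul_pos (mul_pos (sub_pos.2 hlt) (neg_pos.2 hlog)) hP1]
  obtain ⟨t, ht, h⟩ := exists_pressure_eq_zero hP
  exact ⟨t, ⟨ht, h⟩, fun s hs => le_antisymm (key _ _ hs.2 h) (key _ _ h hs.2)⟩

lemma Admissible.sum_eq {p : Fin m → ℝ} {P : (i : Fin m) → Fin (D.rows i) → ℝ}
    (h : D.Admissible p P) : ∑ i, ∑ j, P i j = ∑ i, p i :=
  Finset.sum_congr rfl fun i _ => h.2 i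

lemma mul_log_div_eq {x y : ℝ} (hy : y ≠ 0) :
    x * Real.log (x / y) = x * Real.log x - x * Real.log y := by
  rcases eq_or_ne x 0 with rfl | hx
  · simp
  · rw [Real.log_div hx hy]; ring

lemma Admissible.entropy_eq {p : Fin m → ℝ} (hp : ∀ i, 0 < p i)
    {P : (i : Fin m) → Fin (D.rows i) → ℝ} (h : D.Admissible p P) :
    (∑ i, ∑ j, P i j * Real.log (P i j)) - ∑ i, p i * Real.log (p i)
      = ∑ i, ∑ j, P i j * Real.log (P i j / p i) := by
  rw [← Finset.sum_sub_distrib]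
  refine Finset.sum_congr rfl fun i _ => ?_
  rw [← h.2 i, Finset.sum_mul, ← Finset.sum_sub_distrib]
  refine Finset.sum_congr rfl fun j _ => ?_
  rw [mul_log_div_eq (by rw [h.2 i]; exact (hp i).ne'), h.2 i]

lemma sum_mul_log_b_neg {N : (i : Fin m) → Fin (D.rows i) → ℝ} (hN : ∀ i j, 0 ≤ N i j)
    (hN1 : 0 < ∑ i, ∑ j, N i j) : ∑ i, ∑ j, N i j * Real.log (D.b i j) < 0 := by
  obtain ⟨B, hB0, hB1, hB⟩ := D.exists_b_bound
  have hlog : Real.log B < 0 := Real.log_neg hB0 hB1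
  have : ∑ i, ∑ j, N i j * Real.log (D.b i j) ≤ (∑ i, ∑ j, N i j) * Real.log B := by
    simp only [Finset.sum_mul]
    exact Finset.sum_le_sum fun i _ => Finset.sum_le_sum fun j _ =>
      mul_le_mul_of_nonneg_left (Real.log_le_log (D.b_pos i j) (hB i j)) (hN i j)
  nlinarith

lemma Admissible.baseDim_mul {p : Fin m → ℝ} (hp : ∀ i, 0 < p i) (hp1 : ∑ i, p i = 1)
    {P : (i : Fin m) → Fin (D.rows i) → ℝ} (h : D.Admissible p P) :
    D.baseDim p P * ∑ i, ∑ j, P i j * Real.log (D.b i j)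
      = ∑ i, ∑ j, P i j * Real.log (P i j / p i) := by
  have := sum_mul_log_b_neg h.1 (by rw [h.sum_eq, hp1]; exact one_pos)
  rw [baseDim, h.entropy_eq hp, div_mul_cancel₀ _ this.ne]

lemma Admissible.le {p : Fin m → ℝ} {P : (i : Fin m) → Fin (D.rows i) → ℝ}
    (h : D.Admissible p P) (i : Fin m) (j : Fin (D.rows i)) : P i j ≤ p i := by
  rw [← h.2 i]
  exact Finset.single_le_sum (fun j _ => h.1 i j) (Finset.mem_univ j)

lemma Admissible.baseDim_nonneg {p : Fin m → ℝ} (hp : ∀ i, 0 < p i) (hp1 : ∑ i, p i = 1)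
    {P : (i : Fin m) → Fin (D.rows i) → ℝ} (h : D.Admissible p P) : 0 ≤ D.baseDim p P := by
  have := sum_mul_log_b_neg h.1 (by rw [h.sum_eq, hp1]; exact one_pos)
  rw [baseDim, h.entropy_eq hp]
  refine div_nonneg_of_nonpos ?_ this.le
  refine Finset.sum_nonpos fun i _ => Finset.sum_nonpos fun j _ => ?_
  exact mul_nonpos_of_nonneg_of_nonpos (h.1 i j) (Real.log_nonpos
    (div_nonneg (h.1 i j) (hp i).le) ((div_le_one (hp i)).2 (h.le i j)))

/-- Gibbs' inequality bounds `λ(P)` by `1`. -/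
lemma Admissible.baseDim_le_one {p : Fin m → ℝ} (hp : ∀ i, 0 < p i) (hp1 : ∑ i, p i = 1)
    {P : (i : Fin m) → Fin (D.rows i) → ℝ} (h : D.Admissible p P) : D.baseDim p P ≤ 1 := by
  have hneg := sum_mul_log_b_neg h.1 (by rw [h.sum_eq, hp1]; exact one_pos)
  rw [baseDim, h.entropy_eq hp, div_le_one_of_neg hneg, ← sub_nonpos, ← Finset.sum_sub_distrib]
  refine Finset.sum_nonpos fun i _ => ?_
  rw [← Finset.sum_sub_distrib]
  have : ∀ j, P i j * Real.log (D.b i j) - P i j * Real.log (P i j / p i)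
      ≤ p i * D.b i j - P i j := by
    intro j
    rcases (h.1 i j).eq_or_lt with h0 | h0
    · rw [← h0]
      simpa using mul_nonneg (hp i).le (D.b_pos i j).le
    · have hb := D.b_pos i j
      have hpi := hp i
      rw [← mul_sub, ← Real.log_div hb.ne' (div_pos h0 hpi).ne']
      -- `log x ≤ x - 1` for the ratio of `b i j` to the conditional probability; summing over `j`
      -- then uses `∑ b ≤ 1`.
      have h1 := Real.log_le_sub_one_of_pos (x := D.b i j / (P i j / p i)) (by positivity)
      refine (mul_le_mul_of_nonneg_left h1 h0.le).trans_eq ?_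
      field_simp
  refine (Finset.sum_le_sum fun j _ => this j).trans ?_
  rw [Finset.sum_sub_distrib, ← Finset.mul_sum, h.2 i]
  nlinarith [hp i, D.sum_b_le i]

lemma bddAbove_dimValues {p : Fin m → ℝ} (hp : ∀ i, 0 < p i) (hp1 : ∑ i, p i = 1) :
    BddAbove (D.dimValues p) := by
  refine ⟨2, ?_⟩
  rintro _ ⟨P, t, hP, ht, rfl⟩
  linarith [hP.baseDim_le_one hp hp1, ht.1.2]

lemma nonempty_dimValues {p : Fin m → ℝ} (hp : ∀ i, 0 < p i) :
    (D.dimValues p).Nonempty := by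
  have hP : D.Admissible p fun i _ => p i / D.rows i := by
    refine ⟨fun i j => div_nonneg (hp i).le (Nat.cast_nonneg _), fun i => ?_⟩
    have : (D.rows i : ℝ) ≠ 0 := by have := D.rows_pos i; positivity
    simp [mul_div_cancel₀ _ this]
  obtain ⟨t, ht, h⟩ := exists_pressure_eq_zero hP.1
  exact ⟨_, _, t, hP, ⟨ht, h⟩, rfl⟩

/-- The bound `λ(P) ≤ δ - t` with its negative denominator cleared, a form that stays meaningful for
unnormalized counts. -/
lemma entropy_ge_of_mem_upperBounds {p : Fin m → ℝ} (hp : ∀ i, 0 < p i) (hp1 : ∑ i, p i = 1)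
    {δ : ℝ} (hδ : δ ∈ upperBounds (D.dimValues p)) {P : (i : Fin m) → Fin (D.rows i) → ℝ}
    (hP : D.Admissible p P) {t : ℝ} (ht : D.IsFiberDim P t) :
    (δ - t) * ∑ i, ∑ j, P i j * Real.log (D.b i j)
      ≤ ∑ i, ∑ j, P i j * Real.log (P i j / p i) := by
  rw [← hP.baseDim_mul hp hp1]
  refine mul_le_mul_of_nonpos_right ?_
    (sum_mul_log_b_neg hP.1 (by rw [hP.sum_eq, hp1]; exact one_pos)).le
  linarith [hδ ⟨P, t, hP, ht, rfl⟩]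

/-- The variational bound is stable under perturbations of the marginal `p`. -/
lemma entropy_ge_of_near {p : Fin m → ℝ} (hp : ∀ i, 0 < p i) (hp1 : ∑ i, p i = 1)
    {δ : ℝ} (hδ : δ ∈ upperBounds (D.dimValues p)) {ε : ℝ} (hε : 0 < ε) :
    ∃ η > 0, ∀ (N : (i : Fin m) → Fin (D.rows i) → ℝ) (T t : ℝ), (∀ i j, 0 ≤ N i j) → 0 < T →
      (∀ i, |∑ j, N i j - T * p i| ≤ η * (T * p i)) → t ∈ Icc (0 : ℝ) 1 → D.pressure N t = 0 →
      (δ + ε - t) * ∑ i, ∑ j, N i j * Real.log (D.b i j)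
        ≤ ∑ i, ∑ j, N i j * Real.log (N i j / ∑ j', N i j') := by
  obtain ⟨B, hB0, hB1, hB⟩ := D.exists_b_bound
  have hβ : 0 < -Real.log B := neg_pos.2 (Real.log_neg hB0 hB1)
  obtain ⟨M, hM0, hM⟩ := D.exists_log_rowSum_bound
  set β := -Real.log B with hβdef
  -- The three bounds keep row masses comparable to `T * p i`, absorb the factor `(1 + η) / (1 - η)`
  -- into `ε / 2`, and keep the zeros of the two pressures within `ε / 2`.
  refine ⟨min (1 / 2) (min (ε / (8 * (|δ| + 1))) (ε * β / (4 * M))), by positivity, ?_⟩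
  set η := min (1 / 2) (min (ε / (8 * (|δ| + 1))) (ε * β / (4 * M))) with hη
  have hη0 : 0 < η := by positivity
  have hη1 : η ≤ 1 / 2 := min_le_left _ _
  have hη2 : η * (8 * (|δ| + 1)) ≤ ε := by
    rw [← le_div_iff₀ (by positivity)]
    exact (min_le_right _ _).trans (min_le_left _ _)
  have hη3 : η * (4 * M) ≤ ε * β := by
    rw [← le_div_iff₀ (by positivity)]
    exact (min_le_right _ _).trans (min_le_right _ _)
  clear_value η
  intro N T t' hN hT hnear ht' hzero
  set R : Fin m → ℝ := fun i => ∑ j, N i j with hR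
  have hTp : ∀ i, 0 < T * p i := fun i => mul_pos hT (hp i)
  have hRu : ∀ i, R i ≤ (1 + η) * (T * p i) := fun i => by
    have := (abs_le.1 (hnear i)).2
    simp only [hR]; linarith
  have hRl : ∀ i, (1 - η) * (T * p i) ≤ R i := fun i => by
    have := (abs_le.1 (hnear i)).1
    simp only [hR]; linarith
  have hRpos : ∀ i, 0 < R i := fun i => by nlinarith [hRl i, hTp i]
  -- `N` is rescaled for each `i` to have exact marginal `p`; conditional row probabilities are
  -- unchanged.
  set P : (i : Fin m) → Fin (D.rows i) → ℝ := fun i j => p i * (N i j / R i) with hPdef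
  have hP : D.Admissible p P := by
    refine ⟨fun i j => mul_nonneg (hp i).le (div_nonneg (hN i j) (hRpos i).le), fun i => ?_⟩
    simp only [hPdef, ← Finset.mul_sum, ← Finset.sum_div]
    rw [show ∑ j, N i j = R i from rfl, div_self (hRpos i).ne', mul_one]
  obtain ⟨t, ht, htz⟩ := exists_pressure_eq_zero hP.1
  have hδt := entropy_ge_of_mem_upperBounds hp hp1 hδ hP ⟨ht, htz⟩
  have hNP : ∀ i j, N i j = (R i / p i) * P i j := fun i j => by
    have := (hRpos i).ne'; have := (hp i).ne'
    simp only [hPdef]; field_simp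
  set H : Fin m → ℝ := fun i => -∑ j, P i j * Real.log (P i j / p i) with hH
  set X : Fin m → ℝ := fun i => -∑ j, P i j * Real.log (D.b i j) with hX
  have hH0 : ∀ i, 0 ≤ H i := fun i => neg_nonneg.2 <| Finset.sum_nonpos fun j _ =>
    mul_nonpos_of_nonneg_of_nonpos (hP.1 i j) (Real.log_nonpos
      (div_nonneg (hP.1 i j) (hp i).le) ((div_le_one (hp i)).2 (hP.le i j)))
  have hX0 : ∀ i, 0 ≤ X i := fun i => neg_nonneg.2 <| Finset.sum_nonpos fun j _ =>
    mul_nonpos_of_nonneg_of_nonpos (hP.1 i j) (Real.log_nonpos (D.b_pos i j).le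
      (D.b_lt_one i j).le)
  have hXpos : 0 < ∑ i, X i := by
    have := sum_mul_log_b_neg hP.1 (by rw [hP.sum_eq, hp1]; exact one_pos)
    simp only [hX, Finset.sum_neg_distrib]; linarith
  have hHX : ∑ i, H i ≤ (δ - t) * ∑ i, X i := by
    simp only [hH, hX, Finset.sum_neg_distrib]; linarith
  have hδt0 : 0 ≤ δ - t := by
    have := (Finset.sum_nonneg fun i (_ : i ∈ Finset.univ) => hH0 i).trans hHX
    exact nonneg_of_mul_nonneg_left this hXpos
  have eL : ∑ i, ∑ j, N i j * Real.log (D.b i j) = -∑ i, R i / p i * X i := by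
    rw [← Finset.sum_neg_distrib]
    refine Finset.sum_congr rfl fun i _ => ?_
    simp only [hX, mul_neg, neg_neg, Finset.mul_sum]
    refine Finset.sum_congr rfl fun j _ => ?_
    rw [hNP i j]; ring
  have eR : ∑ i, ∑ j, N i j * Real.log (N i j / ∑ j', N i j') = -∑ i, R i / p i * H i := by
    rw [← Finset.sum_neg_distrib]
    refine Finset.sum_congr rfl fun i _ => ?_
    simp only [hH, mul_neg, neg_neg, Finset.mul_sum]
    refine Finset.sum_congr rfl fun j _ => ?_
    have : N i j / ∑ j', N i j' = P i j / p i := by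
      have := (hp i).ne'
      simp only [hPdef]; field_simp; simp only [hR]
    rw [this, hNP i j]; ring
  have e1 : ∑ i, R i / p i * H i ≤ (1 + η) * T * ∑ i, H i := by
    rw [Finset.mul_sum]
    refine Finset.sum_le_sum fun i _ => mul_le_mul_of_nonneg_right ?_ (hH0 i)
    rw [div_le_iff₀ (hp i)]; linarith [hRu i]
  have e2 : (1 - η) * T * ∑ i, X i ≤ ∑ i, R i / p i * X i := by
    rw [Finset.mul_sum]
    refine Finset.sum_le_sum fun i _ => mul_le_mul_of_nonneg_right ?_ (hX0 i)
    rw [le_div_iff₀ (hp i)]; linarith [hRl i]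
  -- At the zero `t` for `P` the pressure of `N` is at most `η * T * M`, while its slope is at most
  -- `-β * T / 2`, so its own zero `t'` cannot lie far to the right.
  have htt : t' ≤ t + ε / 2 := by
    rcases le_total t' t with h | h
    · linarith
    have f1 := pressure_le hN hB0 hB h
    have f2 : D.pressure N t ≤ η * T * M := by
      have g1 : D.pressure N t = D.pressure N t - T * D.pressure P t := by rw [htz]; ring
      rw [g1]
      have g2 : ∀ i, |∑ j, P i j * Real.log (D.rowSum t i j)| ≤ p i * M := by
        intro i
        refine (Finset.abs_sum_le_sum_abs _ _).trans ?_
        rw [← hP.2 i, Finset.sum_mul]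
        refine Finset.sum_le_sum fun j _ => ?_
        rw [abs_mul, abs_of_nonneg (hP.1 i j)]
        exact mul_le_mul_of_nonneg_left (hM t ht i j) (hP.1 i j)
      have g3 : D.pressure N t - T * D.pressure P t
          = ∑ i, ((R i - T * p i) / p i) * ∑ j, P i j * Real.log (D.rowSum t i j) := by
        simp only [pressure, Finset.mul_sum, ← Finset.sum_sub_distrib]
        refine Finset.sum_congr rfl fun i _ => Finset.sum_congr rfl fun j _ => ?_
        have := (hp i).ne'
        rw [hNP i j]; field_simp
      rw [g3]
      calc _ ≤ ∑ i, η * T * M * p i := by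
            refine Finset.sum_le_sum fun i _ => (le_abs_self _).trans ?_
            rw [abs_mul, abs_div, abs_of_pos (hp i)]
            have hpi := hp i
            have g4 : |R i - T * p i| / p i ≤ η * T := by
              rw [div_le_iff₀ hpi]; exact (hnear i).trans_eq (by ring)
            calc _ ≤ η * T * (p i * M) := mul_le_mul g4 (g2 i) (abs_nonneg _) (by positivity)
              _ = _ := by ring
        _ = η * T * M := by rw [← Finset.mul_sum, hp1, mul_one]
    have f3 : T / 2 ≤ ∑ i, ∑ j, N i j := by
      calc T / 2 ≤ ∑ i, (1 - η) * (T * p i) := by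
            rw [← Finset.mul_sum, ← Finset.mul_sum, hp1]; nlinarith
        _ ≤ _ := Finset.sum_le_sum fun i _ => hRl i
    rw [hzero] at f1
    have f4 : (t' - t) * β * (T / 2) ≤ η * T * M := by
      have := mul_le_mul_of_nonneg_left f3 (mul_nonneg (sub_nonneg.2 h) hβ.le)
      simp only [hβdef] at this ⊢
      linarith
    have f5 : (t' - t) * β ≤ ε / 2 * β := by
      have : (t' - t) * β / 2 ≤ η * M := by
        refine le_of_mul_le_mul_right ?_ hT
        linarith
      linarith
    linarith [le_of_mul_le_mul_right f5 hβ]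
  rw [eL, eR]
  have e3 : ∑ i, R i / p i * H i ≤ (δ - t + ε / 2) * ∑ i, R i / p i * X i := by
    set SX := ∑ i, X i
    have d1 : ∑ i, R i / p i * H i ≤ (1 + η) * T * ((δ - t) * SX) :=
      e1.trans (mul_le_mul_of_nonneg_left hHX (by positivity))
    have d2 : (1 + η) * (δ - t) ≤ (δ - t + ε / 2) * (1 - η) := by
      have : δ ≤ |δ| := le_abs_self δ
      nlinarith [ht.1, mul_nonneg hη0.le (abs_nonneg δ)]
    have d3 : (1 + η) * T * ((δ - t) * SX) ≤ (δ - t + ε / 2) * ((1 - η) * T * SX) := by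
      have := mul_le_mul_of_nonneg_right d2 (mul_pos hT hXpos).le
      linarith
    exact d1.trans (d3.trans (mul_le_mul_of_nonneg_left e2 (by linarith)))
  have e4 : (δ - t + ε / 2) * ∑ i, R i / p i * X i ≤ (δ + ε - t') * ∑ i, R i / p i * X i :=
    mul_le_mul_of_nonneg_right (by linarith) (Finset.sum_nonneg fun i _ =>
      mul_nonneg (div_pos (hRpos i) (hp i)).le (hX0 i))
  linarith

end CarpetFamily

/-! ### A strong law for bounded independent coordinates. -/

section LawOfLargeNumbers

open ProbabilityTheory

variable {X : ℕ → Type*} [∀ l, MeasurableSpace (X l)] {μ : ∀ l, Measure (X l)}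
  [∀ l, IsProbabilityMeasure (μ l)]

lemma integral_eval_infinitePi {l : ℕ} {f : X l → ℝ} (hf : Measurable f) :
    ∫ ω, f (ω l) ∂(Measure.infinitePi μ) = ∫ x, f x ∂(μ l) := by
  rw [← Measure.infinitePi_map_eval μ l, integral_map (measurable_pi_apply l).aemeasurable
    hf.aestronglyMeasurable]

/-- Hoeffding's inequality makes the exceptional probabilities geometrically small, and
Borel–Cantelli concludes. Differing laws are allowed because, once `i` is fixed, the `l`-th letter
has a law depending on `i l`. -/
lemma ae_eventually_sum_lt {f : ∀ l, X l → ℝ} (hf : ∀ l, Measurable (f l)) {M : ℝ}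
    (hM : ∀ l x, |f l x| ≤ M) {ε : ℝ} (hε : 0 < ε) :
    ∀ᵐ ω ∂(Measure.infinitePi μ), ∀ᶠ n : ℕ in atTop,
      ∑ l ∈ Finset.range n, (f l (ω l) - ∫ x, f l x ∂(μ l)) < ε * n := by
  -- The bound is enlarged so that the sub-Gaussian constant is positive.
  have hM' : ∀ l x, |f l x| ≤ |M| + 1 := fun l x => (hM l x).trans (by linarith [le_abs_self M])
  set K := |M| + 1 with hK
  have hK0 : 0 < K := by positivity
  set c : NNReal := (‖K - -K‖₊ / 2) ^ 2 with hc
  have hc0 : 0 < c := by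
    have : K - -K ≠ 0 := by linarith
    have : 0 < ‖K - -K‖₊ := nnnorm_pos.2 this
    positivity
  have hsub : ∀ l, HasSubgaussianMGF (fun ω : ∀ l, X l => f l (ω l) - ∫ x, f l x ∂(μ l)) c
      (Measure.infinitePi μ) := by
    intro l
    have := hasSubgaussianMGF_of_mem_Icc (μ := Measure.infinitePi μ) (a := -K) (b := K)
      (X := fun ω : ∀ l, X l => f l (ω l)) (((hf l).comp (measurable_pi_apply l)).aemeasurable)
      (ae_of_all _ fun ω => abs_le.1 (hM' l (ω l)))
    rwa [integral_eval_infinitePi (hf l)] at this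
  have hind : iIndepFun (fun l (ω : ∀ l, X l) => f l (ω l) - ∫ x, f l x ∂(μ l))
      (Measure.infinitePi μ) :=
    iIndepFun_infinitePi (X := fun l x => f l x - ∫ x, f l x ∂(μ l))
      fun l => (hf l).sub_const _
  set s : ℕ → Set (∀ l, X l) := fun n =>
    {ω | ε * n ≤ ∑ l ∈ Finset.range n, (f l (ω l) - ∫ x, f l x ∂(μ l))} with hs
  set ρ := Real.exp (-ε ^ 2 / (2 * c)) with hρ
  have hρ1 : ρ < 1 := by
    rw [hρ, Real.exp_lt_one_iff, neg_div]
    have : (0 : ℝ) < c := by exact_mod_cast hc0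
    have : 0 < ε ^ 2 / (2 * c) := by positivity
    linarith
  have hbound : ∀ n, Measure.infinitePi μ (s n) ≤ ENNReal.ofReal (ρ ^ n) := by
    intro n
    rw [← ofReal_measureReal]
    refine ENNReal.ofReal_le_ofReal ?_
    refine (HasSubgaussianMGF.measure_sum_range_ge_le_of_iIndepFun hind (n := n)
      (fun l _ => hsub l) (ε := ε * n) (by positivity)).trans_eq ?_
    rw [hρ, ← Real.exp_nat_mul]
    congr 1
    rcases Nat.eq_zero_or_pos n with rfl | hn
    · simp
    · have : (n : ℝ) ≠ 0 := by positivity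
      have : (c : ℝ) ≠ 0 := by exact_mod_cast hc0.ne'
      field_simp
  have hsum : ∑' n, Measure.infinitePi μ (s n) ≠ ⊤ := by
    refine ne_top_of_le_ne_top ?_ (ENNReal.tsum_le_tsum hbound)
    exact (summable_geometric_of_lt_one (Real.exp_pos _).le hρ1).tsum_ofReal_ne_top
  filter_upwards [ae_eventually_notMem hsum] with ω hω
  filter_upwards [hω] with n hn
  exact not_le.1 hn

/-- A strong law of large numbers for bounded independent, not identically distributed,
coordinates. -/
lemma ae_tendsto_average {f : ∀ l, X l → ℝ} (hf : ∀ l, Measurable (f l)) {M : ℝ}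
    (hM : ∀ l x, |f l x| ≤ M) :
    ∀ᵐ ω ∂(Measure.infinitePi μ), Tendsto (fun n : ℕ =>
      (∑ l ∈ Finset.range n, (f l (ω l) - ∫ x, f l x ∂(μ l))) / n) atTop (𝓝 0) := by
  have h1 : ∀ᵐ ω ∂(Measure.infinitePi μ), ∀ k : ℕ, ∀ᶠ n : ℕ in atTop,
      ∑ l ∈ Finset.range n, (f l (ω l) - ∫ x, f l x ∂(μ l)) < (1 / (k + 1 : ℝ)) * n :=
    ae_all_iff.2 fun k => ae_eventually_sum_lt hf hM (by positivity)
  have h2 : ∀ᵐ ω ∂(Measure.infinitePi μ), ∀ k : ℕ, ∀ᶠ n : ℕ in atTop,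
      ∑ l ∈ Finset.range n, (-f l (ω l) - ∫ x, -f l x ∂(μ l)) < (1 / (k + 1 : ℝ)) * n :=
    ae_all_iff.2 fun k => ae_eventually_sum_lt (f := fun l x => -f l x) (fun l => (hf l).neg)
      (M := M) (fun l x => by rw [abs_neg]; exact hM l x) (by positivity)
  filter_upwards [h1, h2] with ω h1 h2
  rw [Metric.tendsto_nhds]
  intro ε hε
  obtain ⟨k, hk⟩ := exists_nat_one_div_lt hε
  filter_upwards [h1 k, h2 k, eventually_gt_atTop 0] with n e1 e2 hn
  have hn' : (0 : ℝ) < n := by exact_mod_cast hn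
  simp only [integral_neg, ← neg_sub', Finset.sum_neg_distrib] at e2
  rw [dist_zero_right, Real.norm_eq_abs, abs_div, abs_of_pos hn', div_lt_iff₀ hn', abs_lt]
  constructor <;> nlinarith

end LawOfLargeNumbers

/-! ### Almost sure letter frequencies. -/

section Bernoulli

variable {m : ℕ}

lemma isProbabilityMeasure_sum_dirac {ι : Type*} [Fintype ι] [MeasurableSpace ι] {q : ι → ℝ}
    (hq : ∀ x, 0 ≤ q x) (hq1 : ∑ x, q x = 1) :
    IsProbabilityMeasure (∑ x, ENNReal.ofReal (q x) • Measure.dirac x) := by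
  constructor
  simp only [Measure.finsetSum_apply, Measure.smul_apply, measure_univ, smul_eq_mul, mul_one]
  rw [← ENNReal.ofReal_sum_of_nonneg fun x _ => hq x, hq1, ENNReal.ofReal_one]

lemma integral_sum_dirac {ι : Type*} [Fintype ι] [MeasurableSpace ι] [MeasurableSingletonClass ι]
    {q : ι → ℝ} (hq : ∀ x, 0 ≤ q x) (f : ι → ℝ) :
    ∫ x, f x ∂(∑ x, ENNReal.ofReal (q x) • Measure.dirac x) = ∑ x, q x * f x := by
  rw [integral_finsetSum_measure]
  · refine Finset.sum_congr rfl fun x _ => ?_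
    rw [integral_smul_measure, integral_dirac, ENNReal.toReal_ofReal (hq x), smul_eq_mul]
  · exact fun x _ => (integrable_dirac (by simp)).smul_measure ENNReal.ofReal_ne_top

/-- The number of occurrences of the letter `x` among the first `n` terms of `i`. -/
def letterCount {α : Type*} [DecidableEq α] (i : ℕ → α) (x : α) (n : ℕ) : ℕ :=
  ((Finset.range n).filter fun l => i l = x).card

lemma sum_range_eq_sum_letterCount {α : Type*} [DecidableEq α] [Fintype α] (i : ℕ → α) (n : ℕ)
    (f : α → ℝ) : ∑ l ∈ Finset.range n, f (i l) = ∑ x, letterCount i x n * f x := by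
  rw [← Finset.sum_fiberwise (s := Finset.range n) (g := i)]
  refine Finset.sum_congr rfl fun x _ => ?_
  rw [letterCount, ← nsmul_eq_mul, ← Finset.sum_const]
  refine Finset.sum_congr rfl fun l hl => ?_
  rw [(Finset.mem_filter.1 hl).2]

lemma ae_bernoulli_frequency {p : Fin m → ℝ} (hp : ∀ i, 0 < p i) (hp1 : ∑ i, p i = 1) :
    ∀ᵐ i ∂(bernoulliMeasure p), ∀ x, Tendsto (fun n : ℕ => (letterCount i x n : ℝ) / n)
      atTop (𝓝 (p x)) := by
  have : IsProbabilityMeasure (∑ i : Fin m, ENNReal.ofReal (p i) • Measure.dirac i) :=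
    isProbabilityMeasure_sum_dirac (fun x => (hp x).le) hp1
  rw [ae_all_iff]
  intro x
  have key := ae_tendsto_average (X := fun _ => Fin m)
    (μ := fun _ => ∑ i : Fin m, ENNReal.ofReal (p i) • Measure.dirac i)
    (f := fun _ y => if y = x then 1 else 0) (fun _ => .of_discrete) (M := 1)
    (fun _ y => by split_ifs <;> simp)
  rw [bernoulliMeasure]
  filter_upwards [key] with i hi
  have h2 := hi.add_const (p x)
  rw [zero_add] at h2
  refine h2.congr' ?_
  filter_upwards [eventually_gt_atTop 0] with n hn
  have hn' : (n : ℝ) ≠ 0 := by positivity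
  rw [integral_sum_dirac fun x => (hp x).le]
  simp only [Finset.sum_sub_distrib, Finset.sum_const, Finset.card_range, nsmul_eq_mul, mul_ite,
    mul_one, mul_zero, Finset.sum_ite_eq', Finset.mem_univ, if_true, letterCount,
    Finset.card_filter]
  push_cast
  field_simp
  ring

end Bernoulli

/-! ### Upper bound: empirical types, weights of cells and good levels. -/

namespace CarpetFamily

variable {m : ℕ} {D : CarpetFamily m} {i : ℕ → Fin m}

lemma hgt_strictAnti (ω : D.Word i) : StrictAnti (hgt ω) := by
  refine strictAnti_nat_of_succ_lt fun n => ?_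
  rw [hgt, scaleProd_succ]
  exact mul_lt_of_lt_one_right (hgt_pos ω n) (wordB_lt ω n)

lemma exists_hgt_le (ω : D.Word i) {r : ℝ} (hr : 0 < r) : ∃ n, hgt ω n ≤ r := by
  obtain ⟨B, -, hB1, hB⟩ := D.exists_b_bound
  exact exists_scaleProd_le (wordB_pos ω) hB1 (fun l => hB _ _) hr

lemma wid_le_one (ω : D.Word i) (n : ℕ) : wid ω n ≤ 1 := by
  have := scaleProd_antitone (wordA_pos ω) (wordA_lt ω) (Nat.zero_le n)
  rwa [scaleProd_zero] at this

/-- The row level whose height matches the width at level `L`. -/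
def matchLevel (ω : D.Word i) (L : ℕ) : ℕ := firstLE (hgt ω) (wid ω L)

lemma hgt_matchLevel_le (ω : D.Word i) (L : ℕ) : hgt ω (matchLevel ω L) ≤ wid ω L :=
  firstLE_spec (exists_hgt_le ω (wid_pos ω L))

lemma le_matchLevel (ω : D.Word i) (L : ℕ) : L ≤ matchLevel ω L := by
  by_contra! h
  exact absurd ((hgt_matchLevel_le ω L).trans (wid_le_hgt ω L)) (not_le.2 (hgt_strictAnti ω h))

/-- The number of occurrences of each row among the first `n` letters of a word. -/
def rowCount (ω : D.Word i) (n : ℕ) (x : Fin m) (j : Fin (D.rows x)) : ℝ :=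
  letterCount (fun l => (⟨i l, (ω l).1⟩ : Σ x, Fin (D.rows x))) ⟨x, j⟩ n

lemma rowCount_nonneg (ω : D.Word i) (n : ℕ) (x : Fin m) (j : Fin (D.rows x)) :
    0 ≤ rowCount ω n x j := Nat.cast_nonneg _

lemma sum_range_eq_sum_rowCount (ω : D.Word i) (n : ℕ) (f : (x : Fin m) → Fin (D.rows x) → ℝ) :
    ∑ l ∈ Finset.range n, f (i l) (ω l).1 = ∑ x, ∑ j, rowCount ω n x j * f x j := by
  rw [sum_range_eq_sum_letterCount (fun l => (⟨i l, (ω l).1⟩ : Σ x, Fin (D.rows x))) n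
    fun y => f y.1 y.2, Fintype.sum_sigma]
  rfl

lemma sum_rowCount (ω : D.Word i) (n : ℕ) (x : Fin m) :
    ∑ j, rowCount ω n x j = letterCount i x n := by
  have h1 := sum_range_eq_sum_rowCount ω n fun y _ => if y = x then 1 else 0
  have h2 := sum_range_eq_sum_letterCount i n fun y => if y = x then 1 else 0
  rw [h2] at h1
  simpa [← Finset.sum_mul] using h1.symm

open Classical in
/-- The zero of the pressure of `N` in `[0, 1]`. -/
def fiberDim (N : (x : Fin m) → Fin (D.rows x) → ℝ) : ℝ :=
  if h : ∃ t ∈ Icc (0 : ℝ) 1, D.pressure N t = 0 then h.choose else 0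

lemma fiberDim_spec {N : (x : Fin m) → Fin (D.rows x) → ℝ} (hN : ∀ x j, 0 ≤ N x j) :
    fiberDim N ∈ Icc (0 : ℝ) 1 ∧ D.pressure N (fiberDim N) = 0 := by
  have h := exists_pressure_eq_zero hN
  rw [fiberDim, dif_pos h]
  exact h.choose_spec

/-- At infinitely many scales, the empirical fiber dimension at the width level is not
much larger than the one at the matching height level. -/
lemma exists_good_level (ω : D.Word i) {ε : ℝ} (hε : 0 < ε) (K : ℕ) :
    ∃ L ≥ K, fiberDim (rowCount ω L) ≤ fiberDim (rowCount ω (matchLevel ω L)) + ε := by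
  -- Otherwise iterating `matchLevel` from `K` would lower the fiber dimension by more than `ε` each
  -- time, although it stays in `[0, 1]`.
  by_contra! h
  have hK : ∀ k, K ≤ (matchLevel ω)^[k] K := by
    intro k
    induction k with
    | zero => simp
    | succ k ih =>
      rw [Function.iterate_succ_apply']
      exact ih.trans (le_matchLevel ω _)
  have hdec : ∀ k : ℕ, fiberDim (rowCount ω ((matchLevel ω)^[k] K)) ≤ 1 - k * ε := by
    intro k
    induction k with
    | zero => simpa using (fiberDim_spec (rowCount_nonneg ω K)).1.2
    | succ k ih =>
      rw [Function.iterate_succ_apply']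
      have := h _ (hK k)
      push_cast
      linarith
  obtain ⟨k, hk⟩ := exists_nat_gt (1 / ε)
  rw [div_lt_iff₀ hε] at hk
  linarith [hdec k, (fiberDim_spec (rowCount_nonneg ω ((matchLevel ω)^[k] K))).1.1]

/-- The weight of a letter: rows are weighted by `q`, columns (where they are recorded) by
`a ^ t`. Letters whose column is not recorded are represented by their first column. -/
def letterWeight (q : (x : Fin m) → Fin (D.rows x) → ℝ) (t : ℝ) (full : Prop) [Decidable full]
    (x : Fin m) (w : D.Index x) : ℝ :=
  q x w.1 * if full then D.a x w.1 w.2 ^ t / D.rowSum t x w.1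
    else if (w.2 : ℕ) = 0 then 1 else 0

lemma letterWeight_nonneg {q : (x : Fin m) → Fin (D.rows x) → ℝ} (hq : ∀ x j, 0 ≤ q x j) (t : ℝ)
    (full : Prop) [Decidable full] (x : Fin m) (w : D.Index x) :
    0 ≤ letterWeight q t full x w := by
  refine mul_nonneg (hq _ _) ?_
  split_ifs
  · exact div_nonneg (Real.rpow_nonneg (D.a_pos _ _ _).le _) (D.rowSum_pos _ _ _).le
  · exact zero_le_one
  · exact le_rfl

lemma sum_letterWeight (q : (x : Fin m) → Fin (D.rows x) → ℝ) (t : ℝ)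
    (full : Prop) [Decidable full] (x : Fin m) :
    ∑ w, letterWeight q t full x w = ∑ j, q x j := by
  rw [Fintype.sum_sigma]
  refine Finset.sum_congr rfl fun j _ => ?_
  simp only [letterWeight, ← Finset.mul_sum]
  have : (∑ k : Fin (D.cols x j), if full then D.a x j k ^ t / D.rowSum t x j
      else if (k : ℕ) = 0 then 1 else 0) = 1 := by
    split_ifs with h
    · rw [← Finset.sum_div]
      exact div_self (D.rowSum_pos t x j).ne'
    · rw [Finset.sum_eq_single_of_mem (⟨0, D.cols_pos x j⟩ : Fin (D.cols x j)) (Finset.mem_univ _)]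
      · simp
      · intro k _ hk
        rw [if_neg]
        exact fun h => hk (Fin.ext h)
  rw [this, mul_one]

/-- The weight of the `(L, n)`-cell of a finite word. -/
def cellWeight (i : ℕ → Fin m) (q : (x : Fin m) → Fin (D.rows x) → ℝ) (t : ℝ) (L n : ℕ)
    (w : (l : Fin n) → D.Index (i l)) : ℝ :=
  ∏ l : Fin n, letterWeight q t ((l : ℕ) < L) (i l) (w l)

/-- The sum of products factors over positions, and each factor is a row sum of `q`. -/
lemma sum_cellWeight_le {q : (x : Fin m) → Fin (D.rows x) → ℝ} (hq : ∀ x j, 0 ≤ q x j)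
    (hq1 : ∀ x, ∑ j, q x j ≤ 1) (t : ℝ) (L n : ℕ) :
    ∑ w, cellWeight i q t L n w ≤ 1 := by
  unfold cellWeight
  rw [← Fintype.piFinset_univ, ← Finset.prod_univ_sum (fun _ => Finset.univ)
    (fun (l : Fin n) w => letterWeight q t ((l : ℕ) < L) (i l) w)]
  refine Finset.prod_le_one (fun l _ => ?_) fun l _ => ?_
  · exact Finset.sum_nonneg fun w _ => letterWeight_nonneg hq _ _ _ _
  · rw [sum_letterWeight]
    exact hq1 _

/-- Row-wise normalization of a nonnegative array. -/
def normalizeRows (N : (x : Fin m) → Fin (D.rows x) → ℝ) (x : Fin m) (j : Fin (D.rows x)) : ℝ :=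
  N x j / ∑ j', N x j'

lemma normalizeRows_nonneg {N : (x : Fin m) → Fin (D.rows x) → ℝ} (hN : ∀ x j, 0 ≤ N x j)
    (x : Fin m) (j : Fin (D.rows x)) : 0 ≤ normalizeRows N x j :=
  div_nonneg (hN x j) (Finset.sum_nonneg fun j _ => hN x j)

/-- Equality fails when all counts for `x` vanish: with `y / 0 = 0` the sum is then `0`. -/
lemma sum_normalizeRows_le (N : (x : Fin m) → Fin (D.rows x) → ℝ) (x : Fin m) :
    ∑ j, normalizeRows N x j ≤ 1 := by
  simp only [normalizeRows, ← Finset.sum_div]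
  exact div_self_le_one _

/-- Integer arrays bounded by `n`. -/
abbrev CountArray (D : CarpetFamily m) (n : ℕ) : Type := (Σ x, Fin (D.rows x)) → Fin (n + 1)

def CountArray.toReal {n : ℕ} (N : CountArray D n) (x : Fin m) (j : Fin (D.rows x)) : ℝ :=
  ((N ⟨x, j⟩ : ℕ) : ℝ)

lemma exists_countArray_eq (ω : D.Word i) {L n : ℕ} (h : L ≤ n) :
    ∃ N : CountArray D n, N.toReal = rowCount ω L := by
  refine ⟨fun y => ⟨letterCount (fun l => (⟨i l, (ω l).1⟩ : Σ x, Fin (D.rows x))) y L, ?_⟩, ?_⟩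
  · refine Nat.lt_succ_of_le ((Finset.card_filter_le _ _).trans ?_)
    simpa using h
  · rfl

/-- The sum of the weights of a cell over all types of words of length `n`. -/
def totalWeight (i : ℕ → Fin m) (L n : ℕ) (w : (l : Fin n) → D.Index (i l)) : ℝ :=
  ∑ τ : CountArray D n × CountArray D n,
    cellWeight i (normalizeRows τ.1.toReal) (fiberDim τ.2.toReal) L n w

lemma cellWeight_nonneg {q : (x : Fin m) → Fin (D.rows x) → ℝ} (hq : ∀ x j, 0 ≤ q x j) (t : ℝ)
    (L n : ℕ) (w : (l : Fin n) → D.Index (i l)) : 0 ≤ cellWeight i q t L n w :=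
  Finset.prod_nonneg fun _ _ => letterWeight_nonneg hq _ _ _ _

lemma CountArray.toReal_nonneg {n : ℕ} (N : CountArray D n) (x : Fin m) (j : Fin (D.rows x)) :
    0 ≤ N.toReal x j := Nat.cast_nonneg _

lemma totalWeight_nonneg (L n : ℕ) (w : (l : Fin n) → D.Index (i l)) :
    0 ≤ totalWeight i L n w :=
  Finset.sum_nonneg fun τ _ => cellWeight_nonneg (normalizeRows_nonneg τ.1.toReal_nonneg) _ _ _ _

/-- Each type contributes at most `1`, and the number of pairs of count arrays is polynomial in `n`.
-/
lemma sum_totalWeight_le (L n : ℕ) :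
    ∑ w : (l : Fin n) → D.Index (i l), totalWeight i L n w
      ≤ ((n : ℝ) + 1) ^ (2 * Fintype.card (Σ x, Fin (D.rows x))) := by
  unfold totalWeight
  rw [Finset.sum_comm]
  refine (Finset.sum_le_sum fun τ _ => sum_cellWeight_le
    (normalizeRows_nonneg τ.1.toReal_nonneg) (sum_normalizeRows_le _) _ _ _).trans_eq ?_
  rw [Finset.sum_const, Finset.card_univ, Fintype.card_prod, Fintype.card_fun, Fintype.card_fin]
  ring

/-- The word which forgets the columns from the index `L` on. -/
def truncate (ω : D.Word i) (L : ℕ) : D.Word i :=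
  fun l => if l < L then ω l else ⟨(ω l).1, ⟨0, D.cols_pos _ _⟩⟩

lemma truncate_fst (ω : D.Word i) (L l : ℕ) : (truncate ω L l).1 = (ω l).1 := by
  unfold truncate; split_ifs <;> rfl

lemma letterWeight_truncate (q : (x : Fin m) → Fin (D.rows x) → ℝ) (t : ℝ) (ω : D.Word i)
    (L l : ℕ) : letterWeight q t (l < L) (i l) (truncate ω L l)
      = q (i l) (ω l).1 * if l < L then wordA ω l ^ t / D.rowSum t (i l) (ω l).1 else 1 := by
  by_cases h : l < L
  · have e : truncate ω L l = ω l := if_pos h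
    rw [letterWeight, e, if_pos h, if_pos h, wordA]
  · have e : truncate ω L l = ⟨(ω l).1, ⟨0, D.cols_pos _ _⟩⟩ := if_neg h
    rw [letterWeight, e, if_neg h, if_neg h, if_pos rfl]

lemma prod_mul_ite_lt (ω : D.Word i) (q : (x : Fin m) → Fin (D.rows x) → ℝ) (t : ℝ)
    {L n : ℕ} (h : L ≤ n) :
    (∏ l ∈ Finset.range n, (q (i l) (ω l).1 *
        if l < L then wordA ω l ^ t / D.rowSum t (i l) (ω l).1 else 1))
      = (∏ l ∈ Finset.range n, q (i l) (ω l).1) *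
        (wid ω L ^ t / ∏ l ∈ Finset.range L, D.rowSum t (i l) (ω l).1) := by
  simp only [Finset.prod_mul_distrib]
  congr 1
  rw [← Finset.prod_filter]
  have : (Finset.range n).filter (· < L) = Finset.range L := by
    ext l; simp only [Finset.mem_filter, Finset.mem_range]; omega
  rw [this, Finset.prod_div_distrib, wid, scaleProd,
    Real.finsetProd_rpow _ _ fun l _ => (wordA_pos ω l).le]

lemma cellWeight_truncate (q : (x : Fin m) → Fin (D.rows x) → ℝ) (t : ℝ) (ω : D.Word i)
    {L n : ℕ} (h : L ≤ n) :
    cellWeight i q t L n (fun l => truncate ω L l)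
      = (∏ l ∈ Finset.range n, q (i l) (ω l).1) *
        (wid ω L ^ t / ∏ l ∈ Finset.range L, D.rowSum t (i l) (ω l).1) := by
  unfold cellWeight
  rw [Fin.prod_univ_eq_prod_range
    (fun l => letterWeight q t (l < L) (i l) (truncate ω L l)) n]
  simp only [letterWeight_truncate]
  exact prod_mul_ite_lt ω q t h

/-- A cell does not see columns beyond `L`, so the truncated word is a canonical finite label for
it. -/
lemma cell_extendWord_truncate (ω : D.Word i) {L n : ℕ} (h : L ≤ n) :
    wid (extendWord fun l : Fin n => truncate ω L l) L = wid ω L ∧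
    hgt (extendWord fun l : Fin n => truncate ω L l) n = hgt ω n ∧
    cell (extendWord fun l : Fin n => truncate ω L l) L n = cell ω L n := by
  set ω' := extendWord fun l : Fin n => truncate ω L l with hω'
  have e1 : ∀ l < L, ω' l = ω l := fun l hl => by
    rw [hω', extendWord, dif_pos (hl.trans_le h), truncate, if_pos hl]
  have e2 : ∀ l < n, (ω' l).1 = (ω l).1 := fun l hl => by
    rw [hω', extendWord, dif_pos hl, truncate_fst]
  have hA : ∀ l < L, wordA ω' l = wordA ω l := fun l hl => by rw [wordA, wordA, e1 l hl]
  have hC : ∀ l < L, wordC ω' l = wordC ω l := fun l hl => by rw [wordC, wordC, e1 l hl]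
  have hB : ∀ l < n, wordB ω' l = wordB ω l := fun l hl => by rw [wordB, wordB, e2 l hl]
  have hD : ∀ l < n, wordD ω' l = wordD ω l := fun l hl => by rw [wordD, wordD, e2 l hl]
  have f1 : wid ω' L = wid ω L := scaleProd_congr hA
  have f2 : hgt ω' n = hgt ω n := scaleProd_congr hB
  refine ⟨f1, f2, ?_⟩
  rw [cell, cell, f1, f2, xpos, xpos, ypos, ypos, offset_congr hA hC, offset_congr hB hD]

lemma log_hgt (ω : D.Word i) (n : ℕ) :
    Real.log (hgt ω n) = ∑ l ∈ Finset.range n, Real.log (wordB ω l) := by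
  rw [hgt, scaleProd]
  exact Real.log_prod fun l _ => (wordB_pos ω l).ne'

lemma ediam_cell_le (ω : D.Word i) {L n : ℕ} (h : hgt ω n ≤ wid ω L) :
    Metric.ediam (cell ω L n) ≤ ENNReal.ofReal (wid ω L) := by
  refine Metric.ediam_le fun x hx y hy => ?_
  rw [edist_dist]
  refine ENNReal.ofReal_le_ofReal ?_
  obtain ⟨⟨a1, a2⟩, a3, a4⟩ := hx
  obtain ⟨⟨b1, b2⟩, b3, b4⟩ := hy
  rw [Prod.dist_eq, Real.dist_eq, Real.dist_eq]
  refine max_le ?_ ?_ <;> rw [abs_le] <;> constructor <;> linarith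

end CarpetFamily

lemma letterCount_pos {α : Type*} [DecidableEq α] (i : ℕ → α) {l n : ℕ} (h : l < n) :
    0 < letterCount i (i l) n :=
  Finset.card_pos.2 ⟨l, Finset.mem_filter.2 ⟨Finset.mem_range.2 h, rfl⟩⟩

namespace CarpetFamily

variable {m : ℕ} {D : CarpetFamily m} {i : ℕ → Fin m}

lemma matchLevel_hgt_ge {a₀ : ℝ} (h0 : 0 < a₀) (h1 : a₀ ≤ 1) (ha : ∀ i j k, a₀ ≤ D.a i j k)
    (ω : D.Word i) (L : ℕ) : a₀ * wid ω L ≤ hgt ω (matchLevel ω L) := by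
  refine mul_le_scaleProd_firstLE h0 h1 (fun l => ?_) (wid_pos ω L) (wid_le_one ω L)
  exact (ha _ _ (ω l).2).trans (wordA_le ω l)

/-- The logarithm of the product is the pressure of the empirical counts at its zero, so the
denominators in the column weights disappear. -/
lemma prod_rowSum_fiberDim (ω : D.Word i) (L : ℕ) :
    ∏ l ∈ Finset.range L, D.rowSum (fiberDim (rowCount ω L)) (i l) (ω l).1 = 1 := by
  set t := fiberDim (rowCount ω L) with ht
  have h := (fiberDim_spec (rowCount_nonneg ω L)).2
  rw [← ht, pressure, ← sum_range_eq_sum_rowCount ω L fun x j => Real.log (D.rowSum t x j),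
    ← Real.log_prod fun l _ => (D.rowSum_pos _ _ _).ne'] at h
  exact Real.eq_one_of_pos_of_log_eq_zero (Finset.prod_pos fun l _ => D.rowSum_pos _ _ _) h

lemma prod_normalizeRows (ω : D.Word i) (n : ℕ) :
    ∏ l ∈ Finset.range n, normalizeRows (rowCount ω n) (i l) (ω l).1
      = Real.exp (∑ x, ∑ j, rowCount ω n x j *
          Real.log (rowCount ω n x j / ∑ j', rowCount ω n x j')) := by
  rw [← sum_range_eq_sum_rowCount ω n
    fun x j => Real.log (rowCount ω n x j / ∑ j', rowCount ω n x j'), Real.exp_sum]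
  refine Finset.prod_congr rfl fun l hl => (Real.exp_log ?_).symm
  -- A row used by the word has positive count, so the logarithm has no default value here.
  have h : 0 < rowCount ω n (i l) (ω l).1 := by
    rw [rowCount]
    exact_mod_cast letterCount_pos (fun l => (⟨i l, (ω l).1⟩ : Σ x, Fin (D.rows x)))
      (Finset.mem_range.1 hl)
  exact div_pos h (h.trans_le (Finset.single_le_sum (fun j _ => rowCount_nonneg ω n _ j)
    (Finset.mem_univ (ω l).1)))

lemma cellWeight_le_totalWeight (ω : D.Word i) {L n : ℕ} (h : L ≤ n)
    (w : (l : Fin n) → D.Index (i l)) :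
    cellWeight i (normalizeRows (rowCount ω n)) (fiberDim (rowCount ω L)) L n w
      ≤ totalWeight i L n w := by
  obtain ⟨N, hN⟩ := exists_countArray_eq ω (le_refl n)
  obtain ⟨M, hM⟩ := exists_countArray_eq ω h
  rw [← hN, ← hM, totalWeight]
  generalize hf : (fun τ : CountArray D n × CountArray D n =>
    cellWeight i (normalizeRows τ.1.toReal) (fiberDim τ.2.toReal) L n w) = f
  have h0 : ∀ τ, 0 ≤ f τ := fun τ => by
    rw [← hf]
    exact cellWeight_nonneg (normalizeRows_nonneg τ.1.toReal_nonneg) _ _ _ _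
  have h1 : cellWeight i (normalizeRows N.toReal) (fiberDim M.toReal) L n w = f (N, M) := by
    rw [← hf]
  rw [h1]
  exact Finset.single_le_sum (fun τ _ => h0 τ) (Finset.mem_univ _)

/-- The core of the upper bound. With `t`, `u` the fiber dimensions at levels `n`, `L`, the weight
is `exp E * wid ^ u`, where `E ≥ (δ + ε - t) * log hgt`. Height and width are comparable and `u ≤ t
+ ε`, so the weight is at least a constant times `wid ^ (δ + 2ε)`; the third `ε` yields the factor
`θ ^ n`. -/
lemma exists_good_cell {p : Fin m → ℝ} (hp : ∀ i, 0 < p i) (hp1 : ∑ i, p i = 1)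
    (hi : ∀ x, Tendsto (fun n : ℕ => (letterCount i x n : ℝ) / n) atTop (𝓝 (p x)))
    {δ : ℝ} (hδ : δ ∈ upperBounds (D.dimValues p)) {ε : ℝ} (hε : 0 < ε) :
    ∃ C θ C' ρ : ℝ, 0 < C ∧ 0 < θ ∧ θ < 1 ∧ 0 < ρ ∧ ρ < 1 ∧ ∀ (ω : D.Word i) (K : ℕ),
      ∃ L n : ℕ, K ≤ n ∧ L ≤ n ∧ hgt ω n ≤ wid ω L ∧ wid ω L ≤ C' * ρ ^ n ∧
        wid ω L ^ (δ + 3 * ε) ≤ C * θ ^ n * totalWeight i L n fun l => truncate ω L l := by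
  obtain ⟨B, hB0, hB1, hB⟩ := D.exists_b_bound
  obtain ⟨a₀, ha0, ha1, ha⟩ := D.exists_a_bound
  obtain ⟨η, hη, hnear⟩ := entropy_ge_of_near hp hp1 hδ hε
  have hlB : Real.log B < 0 := Real.log_neg hB0 hB1
  have hla : Real.log a₀ ≤ 0 := Real.log_nonpos ha0.le ha1
  have hfreq : ∀ᶠ n : ℕ in atTop, ∀ x, |(letterCount i x n : ℝ) - n * p x| ≤ η * (n * p x) := by
    rw [eventually_all]
    intro x
    have := Metric.tendsto_nhds.1 (hi x) (η * p x) (mul_pos hη (hp x))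
    filter_upwards [this, eventually_gt_atTop 0] with n hn hn0
    have hn0' : (0 : ℝ) < n := by exact_mod_cast hn0
    rw [Real.dist_eq] at hn
    have e : (letterCount i x n : ℝ) - n * p x = n * (letterCount i x n / n - p x) := by
      field_simp
    rw [e, abs_mul, abs_of_pos hn0']
    nlinarith
  obtain ⟨K₀, hK₀⟩ := eventually_atTop.1 hfreq
  -- In the first constant, the first term pays for replacing height by width, at most a factor `a₀`
  -- apart; the second comes from `a₀ * wid ≤ B ^ n`, which also gives `θ = B ^ ε`.
  refine ⟨Real.exp ((|δ| + ε + 1) * -Real.log a₀ - ε * Real.log a₀), Real.exp (ε * Real.log B),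
    a₀⁻¹, B, Real.exp_pos _, Real.exp_pos _, ?_, hB0, hB1, ?_⟩
  · rw [Real.exp_lt_one_iff]; nlinarith
  intro ω K
  obtain ⟨L, hLK, hL⟩ := exists_good_level ω hε (K + K₀ + 1)
  set n := matchLevel ω L with hn
  have hLn : L ≤ n := le_matchLevel ω L
  have hhw : hgt ω n ≤ wid ω L := hgt_matchLevel_le ω L
  have hwh : a₀ * wid ω L ≤ hgt ω n := matchLevel_hgt_ge ha0 ha1 ha ω L
  have hhB : hgt ω n ≤ B ^ n := scaleProd_le_pow (wordB_pos ω) (fun l => hB _ _) n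
  have hw0 := wid_pos ω L
  have hw1 : wid ω L ≤ 1 := wid_le_one ω L
  refine ⟨L, n, by omega, hLn, hhw, ?_, ?_⟩
  · rw [inv_mul_eq_div, le_div_iff₀ ha0]
    linarith
  set N := rowCount ω n with hN
  set t := fiberDim N with ht
  set u := fiberDim (rowCount ω L) with hu
  obtain ⟨ht01, htz⟩ := fiberDim_spec (rowCount_nonneg ω n)
  rw [← hN, ← ht] at ht01 htz
  have hE := hnear N n t (rowCount_nonneg ω n) (by exact_mod_cast (by omega : 0 < n))
    (fun x => by rw [hN, sum_rowCount]; exact hK₀ n (by omega) x) ht01 htz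
  rw [hN, ← sum_range_eq_sum_rowCount ω n fun x j => Real.log (D.b x j)] at hE
  change _ * ∑ l ∈ Finset.range n, Real.log (wordB ω l) ≤ _ at hE
  rw [← log_hgt, ← hN] at hE
  set E := ∑ x, ∑ j, N x j * Real.log (N x j / ∑ j', N x j') with hEdef
  have hW : Real.exp E * wid ω L ^ u ≤ totalWeight i L n fun l => truncate ω L l := by
    refine le_trans (le_of_eq ?_) (cellWeight_le_totalWeight ω hLn _)
    rw [cellWeight_truncate _ _ _ hLn, prod_normalizeRows, prod_rowSum_fiberDim, div_one]
  refine le_trans ?_ (mul_le_mul_of_nonneg_left hW (by positivity))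
  rw [Real.rpow_def_of_pos hw0, Real.rpow_def_of_pos hw0, ← Real.exp_nat_mul, ← Real.exp_add,
    ← Real.exp_add, ← Real.exp_add, Real.exp_le_exp]
  set ℓ := Real.log (wid ω L) with hℓ
  set h := Real.log (hgt ω n) with hh
  have f1 : h ≤ ℓ := Real.log_le_log (hgt_pos ω n) hhw
  have f2 : Real.log a₀ + ℓ ≤ h := by
    rw [hℓ, ← Real.log_mul ha0.ne' hw0.ne']
    exact Real.log_le_log (by positivity) hwh
  have f3 : h ≤ n * Real.log B := by
    rw [← Real.log_pow]
    exact Real.log_le_log (hgt_pos ω n) hhB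
  have f4 : ℓ ≤ 0 := Real.log_nonpos hw0.le hw1
  have g1 : -((|δ| + ε + 1) * -Real.log a₀) ≤ (δ + ε - t) * (h - ℓ) := by
    have k1 : |(δ + ε - t) * (h - ℓ)| ≤ (|δ| + ε + 1) * -Real.log a₀ := by
      rw [abs_mul]
      refine mul_le_mul ?_ ?_ (abs_nonneg _) (by positivity)
      · rw [abs_le]
        constructor <;> linarith [ht01.1, ht01.2, le_abs_self δ, neg_abs_le δ]
      · rw [abs_le]
        constructor <;> linarith
    exact (abs_le.1 k1).1
  have g2 : (t + ε - u) * ℓ ≤ 0 := mul_nonpos_of_nonneg_of_nonpos (by linarith) f4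
  have g3 : ε * ℓ ≤ ε * (n * Real.log B - Real.log a₀) :=
    mul_le_mul_of_nonneg_left (by linarith) hε.le
  nlinarith

end CarpetFamily

/-! ### Upper bound: coverings by good cells. -/

lemma summable_natCast_add_one_pow_mul_geometric (k : ℕ) {θ : ℝ} (h0 : 0 < θ) (h1 : θ < 1) :
    Summable fun n : ℕ => ((n : ℝ) + 1) ^ k * θ ^ n := by
  have h := (summable_nat_add_iff 1).2
    (summable_pow_mul_geometric_of_norm_lt_one (R := ℝ) k (r := θ)
      (by rwa [Real.norm_eq_abs, abs_of_pos h0]))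
  refine (h.mul_right θ⁻¹).congr fun n => ?_
  push_cast
  rw [pow_succ]
  field_simp

namespace CarpetFamily

variable {m : ℕ} {D : CarpetFamily m} {i : ℕ → Fin m}

lemma nonneg_of_mem_upperBounds {p : Fin m → ℝ} (hp : ∀ i, 0 < p i) (hp1 : ∑ i, p i = 1)
    {δ : ℝ} (hδ : δ ∈ upperBounds (D.dimValues p)) : 0 ≤ δ := by
  obtain ⟨x, hx⟩ := nonempty_dimValues (D := D) hp
  obtain ⟨P, t, hP, ht, rfl⟩ := id hx
  linarith [hδ hx, hP.baseDim_nonneg hp hp1, ht.1.1]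

/-- The cell of a finite word if it satisfies the given estimates, and the empty set otherwise. -/
def goodCell (i : ℕ → Fin m) (s C θ R : ℝ) (L n : ℕ) (w : (l : Fin n) → D.Index (i l)) :
    Set (ℝ × ℝ) :=
  {z | z ∈ cell (extendWord w) L n ∧ hgt (extendWord w) n ≤ wid (extendWord w) L ∧
    wid (extendWord w) L ≤ R ∧ wid (extendWord w) L ^ s ≤ C * θ ^ n * totalWeight i L n w}

lemma ediam_goodCell_le (s C θ R : ℝ) (L n : ℕ) (w : (l : Fin n) → D.Index (i l)) :
    Metric.ediam (goodCell i s C θ R L n w) ≤ ENNReal.ofReal R := by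
  rcases (goodCell i s C θ R L n w).eq_empty_or_nonempty with h | ⟨z, -, h1, h2, -⟩
  · rw [h]; simp
  · exact (Metric.ediam_mono fun z hz => hz.1).trans
      ((ediam_cell_le _ h1).trans (ENNReal.ofReal_le_ofReal h2))

lemma ediam_goodCell_rpow_le {s : ℝ} (hs : 0 < s) (C θ R : ℝ) (L n : ℕ)
    (w : (l : Fin n) → D.Index (i l)) :
    Metric.ediam (goodCell i s C θ R L n w) ^ s
      ≤ ENNReal.ofReal (C * θ ^ n * totalWeight i L n w) := by
  rcases (goodCell i s C θ R L n w).eq_empty_or_nonempty with h | ⟨z, -, h1, -, h3⟩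
  · rw [h]; simp [hs]
  · refine le_trans (ENNReal.rpow_le_rpow ((Metric.ediam_mono fun z hz => hz.1).trans
      (ediam_cell_le _ h1)) hs.le) ?_
    rw [ENNReal.ofReal_rpow_of_pos (wid_pos _ _)]
    exact ENNReal.ofReal_le_ofReal h3

lemma tsum_goodCell_le {s C θ : ℝ} (hs : 0 < s) (hC : 0 < C) (hθ : 0 < θ) (R : ℕ → ℝ) :
    ∑' y : Σ n : ℕ, Fin (n + 1) × ((l : Fin n) → D.Index (i l)),
      Metric.ediam (goodCell i s C θ (R y.1) y.2.1 y.1 y.2.2) ^ s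
      ≤ ∑' n : ℕ, ENNReal.ofReal
        (C * (((n : ℝ) + 1) ^ (2 * Fintype.card (Σ x, Fin (D.rows x)) + 1) * θ ^ n)) := by
  rw [ENNReal.tsum_sigma']
  refine ENNReal.tsum_le_tsum fun n => ?_
  rw [tsum_fintype, Fintype.sum_prod_type]
  have h : ∀ L : Fin (n + 1), ∑ w : (l : Fin n) → D.Index (i l),
      Metric.ediam (goodCell i s C θ (R n) L n w) ^ s
      ≤ ENNReal.ofReal (C * θ ^ n * ((n : ℝ) + 1) ^ (2 * Fintype.card (Σ x, Fin (D.rows x)))) := by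
    intro L
    refine (Finset.sum_le_sum fun w _ => ediam_goodCell_rpow_le hs C θ (R n) L n w).trans ?_
    rw [← ENNReal.ofReal_sum_of_nonneg fun w _ =>
      mul_nonneg (by positivity) (totalWeight_nonneg _ _ _), ← Finset.mul_sum]
    exact ENNReal.ofReal_le_ofReal
      (mul_le_mul_of_nonneg_left (sum_totalWeight_le _ _) (by positivity))
  refine (Finset.sum_le_sum fun L _ => h L).trans ?_
  rw [← ENNReal.ofReal_sum_of_nonneg fun _ _ => by positivity]
  refine ENNReal.ofReal_le_ofReal (le_of_eq ?_)
  rw [Finset.sum_const, Finset.card_univ, Fintype.card_fin, nsmul_eq_mul]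
  push_cast
  ring

/-- For every `K`, the good cells of levels `n ≥ K` cover the carpet, and their `s`-sums are bounded
by one convergent series; hence the `s`-dimensional measure is finite. -/
lemma dimH_planeCarpet_le {p : Fin m → ℝ} (hp : ∀ i, 0 < p i) (hp1 : ∑ i, p i = 1)
    (hi : ∀ x, Tendsto (fun n : ℕ => (letterCount i x n : ℝ) / n) atTop (𝓝 (p x)))
    {δ : ℝ} (hδ : δ ∈ upperBounds (D.dimValues p)) :
    dimH (planeCarpet D i) ≤ ENNReal.ofReal δ := by
  have hδ0 := nonneg_of_mem_upperBounds hp hp1 hδ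
  suffices h : ∀ ε > 0, dimH (planeCarpet D i) ≤ ENNReal.ofReal (δ + 3 * ε) by
    have hc : Tendsto (fun ε : ℝ => ENNReal.ofReal (δ + 3 * ε)) (𝓝[>] 0)
        (𝓝 (ENNReal.ofReal δ)) := by
      have : Continuous fun ε : ℝ => ENNReal.ofReal (δ + 3 * ε) :=
        ENNReal.continuous_ofReal.comp (by fun_prop)
      simpa using (this.tendsto 0).mono_left nhdsWithin_le_nhds
    exact ge_of_tendsto hc (eventually_mem_nhdsWithin.mono fun ε hε => h ε hε)
  intro ε hε
  have hs : 0 < δ + 3 * ε := by linarith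
  obtain ⟨C, θ, C', ρ, hC, hθ0, hθ1, hρ0, hρ1, key⟩ := exists_good_cell hp hp1 hi hδ hε
  set s := δ + 3 * ε with hsdef
  let ι := Σ n : ℕ, Fin (n + 1) × ((l : Fin n) → D.Index (i l))
  -- Cells below level `K` are made empty, so one index type serves all `K`.
  let t : ℕ → ι → Set (ℝ × ℝ) := fun K y =>
    {z | K ≤ y.1 ∧ z ∈ goodCell i s C θ (C' * ρ ^ y.1) y.2.1 y.1 y.2.2}
  -- The sign follows from the positivity of the width of any good cell.
  have hC' : 0 ≤ C' := by
    by_contra! hneg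
    rcases isEmpty_or_nonempty (D.Word i) with hW | ⟨⟨ω⟩⟩
    · exact hW.false fun l => Classical.arbitrary _
    · obtain ⟨L, n, -, -, -, h, -⟩ := key ω 0
      have := wid_pos ω L
      nlinarith [pow_pos hρ0 n]
  have hfin : ∑' n : ℕ, ENNReal.ofReal
      (C * (((n : ℝ) + 1) ^ (2 * Fintype.card (Σ x, Fin (D.rows x)) + 1) * θ ^ n)) ≠ ⊤ :=
    ((summable_natCast_add_one_pow_mul_geometric _ hθ0 hθ1).mul_left C).tsum_ofReal_ne_top
  have hle := Measure.hausdorffMeasure_le_liminf_tsum (ι := fun _ : ℕ => ι) s (planeCarpet D i)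
    (l := atTop) (fun K : ℕ => ENNReal.ofReal (C' * ρ ^ K)) ?_ t ?_ ?_
  · have hμ : μH[s] (planeCarpet D i) ≠ ⊤ := by
      refine ne_top_of_le_ne_top hfin (hle.trans ?_)
      refine (liminf_le_liminf (v := fun _ => ∑' n : ℕ, ENNReal.ofReal
        (C * (((n : ℝ) + 1) ^ (2 * Fintype.card (Σ x, Fin (D.rows x)) + 1) * θ ^ n)))
        (Eventually.of_forall fun K => ?_)).trans_eq (liminf_const _)
      refine le_trans (ENNReal.tsum_le_tsum fun y => ?_)
        (tsum_goodCell_le hs hC hθ0 fun n => C' * ρ ^ n)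
      exact ENNReal.rpow_le_rpow (Metric.ediam_mono fun z hz => hz.2) hs.le
    have hs' : s = ((s.toNNReal : NNReal) : ℝ) := (Real.coe_toNNReal s hs.le).symm
    rw [hs'] at hμ
    exact dimH_le_of_hausdorffMeasure_ne_top hμ
  · have : Tendsto (fun K : ℕ => C' * ρ ^ K) atTop (𝓝 (C' * 0)) :=
      (tendsto_pow_atTop_nhds_zero_of_lt_one hρ0.le hρ1).const_mul C'
    simpa using ENNReal.tendsto_ofReal this
  · refine Eventually.of_forall fun K y => ?_
    rcases (t K y).eq_empty_or_nonempty with h | ⟨z, hz, -⟩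
    · rw [h]; simp
    · refine (Metric.ediam_mono fun z hz => hz.2).trans ((ediam_goodCell_le _ _ _ _ _ _ _).trans ?_)
      exact ENNReal.ofReal_le_ofReal (mul_le_mul_of_nonneg_left
        (pow_le_pow_of_le_one hρ0.le hρ1.le hz) hC')
  · refine Eventually.of_forall fun K z hz => ?_
    obtain ⟨ω, hω⟩ := hz
    obtain ⟨L, n, hKn, hLn, h1, h2, h3⟩ := key ω K
    obtain ⟨e1, e2, e3⟩ := cell_extendWord_truncate ω hLn
    refine Set.mem_iUnion.2 ⟨⟨n, ⟨L, by omega⟩, fun l => truncate ω L l⟩, hKn, ?_, ?_, ?_, ?_⟩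
    · simp only [e3]
      exact cell_antitone ω hLn le_rfl (hω n)
    · simp only [e1, e2]; exact h1
    · simp only [e1]; exact h2
    · simp only [e1]; exact h3

/-! ### Symbolic cells of a given scale -/

/-- The first index at which the width is at most `r`. -/
def widLevel (ω : D.Word i) (r : ℝ) : ℕ := firstLE (wid ω) r

/-- The first index at which the height is at most `r`. -/
def hgtLevel (ω : D.Word i) (r : ℝ) : ℕ := firstLE (hgt ω) r

lemma exists_wid_le (ω : D.Word i) {r : ℝ} (hr : 0 < r) : ∃ n, wid ω n ≤ r := by
  obtain ⟨n, hn⟩ := exists_hgt_le ω hr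
  exact ⟨n, (wid_le_hgt ω n).trans hn⟩

lemma widLevel_le_hgtLevel (ω : D.Word i) {r : ℝ} (hr : 0 < r) :
    widLevel ω r ≤ hgtLevel ω r :=
  firstLE_le ((wid_le_hgt ω _).trans (firstLE_spec (exists_hgt_le ω hr)))

/-- The words which share the first `L` letters and the first `n` rows with `ω`. -/
def cylinder (ω : D.Word i) (L n : ℕ) : Set (D.Word i) :=
  {ω' | (∀ l < L, ω' l = ω l) ∧ ∀ l < n, (ω' l).1 = (ω l).1}

/-- Interiors of approximate squares of side about `r`: adjacent cells may share edges, but their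
interiors do not meet. -/
def openCell (ω : D.Word i) (r : ℝ) : Set (ℝ × ℝ) :=
  Ioo (xpos ω (widLevel ω r)) (xpos ω (widLevel ω r) + wid ω (widLevel ω r)) ×ˢ
    Ioo (ypos ω (hgtLevel ω r)) (ypos ω (hgtLevel ω r) + hgt ω (hgtLevel ω r))

lemma disjoint_Ioo_of_le {a b c d : ℝ} (h : b ≤ c) : Disjoint (Ioo a b) (Ioo c d) :=
  Set.disjoint_left.2 fun _ hx hy => absurd (hx.2.trans_le h) (not_lt.2 hy.1.le)

lemma row_separated {ω ω' : D.Word i} {l : ℕ} (hl : ∀ k < l, (ω k).1 = (ω' k).1)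
    (h : (ω l).1 < (ω' l).1) {n n' : ℕ} (hn : l < n) (hn' : l < n') :
    ypos ω n + hgt ω n ≤ ypos ω' n' :=
  offset_separated (wordB_pos ω) (wordD_nonneg ω') (wordD_add ω) (wordB_pos ω')
    (fun k hk => by rw [wordB, wordB, hl k hk]) (fun k hk => by rw [wordD, wordD, hl k hk])
    (D.d_add_le h) hn hn'

lemma column_gap {x : Fin m} {w w' : D.Index x} (h : w.1 = w'.1) (hne : w ≠ w') :
    D.c x w.1 w.2 + D.a x w.1 w.2 ≤ D.c x w'.1 w'.2 ∨
      D.c x w'.1 w'.2 + D.a x w'.1 w'.2 ≤ D.c x w.1 w.2 := by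
  obtain ⟨j, k⟩ := w
  obtain ⟨j', k'⟩ := w'
  obtain rfl : j = j' := h
  rcases lt_trichotomy k k' with hk | rfl | hk
  · exact .inl (D.c_add_le hk)
  · exact absurd rfl hne
  · exact .inr (D.c_add_le hk)

lemma column_separated {ω ω' : D.Word i} {l : ℕ} (hl : ∀ k < l, ω k = ω' k)
    (h : wordC ω l + wordA ω l ≤ wordC ω' l) {n n' : ℕ} (hn : l < n) (hn' : l < n') :
    xpos ω n + wid ω n ≤ xpos ω' n' :=
  offset_separated (wordA_pos ω) (wordC_nonneg ω') (wordC_add ω) (wordA_pos ω')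
    (fun k hk => by rw [wordA, wordA, hl k hk]) (fun k hk => by rw [wordC, wordC, hl k hk])
    h hn hn'

/-- A row difference before both height levels separates vertically. Otherwise the height levels
agree, and since `widLevel ≤ hgtLevel` a first letter difference before both width levels lies in a
common row and separates horizontally. With neither, the cylinders coincide. -/
lemma disjoint_openCell {ω ω' : D.Word i} {r : ℝ} (hr : 0 < r)
    (h : ω' ∉ cylinder ω (widLevel ω r) (hgtLevel ω r)) :
    Disjoint (openCell ω r) (openCell ω' r) := by
  classical
  by_cases hrow : ∃ l, l < hgtLevel ω r ∧ l < hgtLevel ω' r ∧ (ω l).1 ≠ (ω' l).1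
  · obtain ⟨h1, h2, h3⟩ := Nat.find_spec hrow
    have hmin : ∀ k < Nat.find hrow, (ω k).1 = (ω' k).1 := fun k hk => by
      by_contra hne
      exact Nat.find_min hrow hk ⟨hk.trans h1, hk.trans h2, hne⟩
    refine Set.disjoint_prod.2 (.inr ?_)
    rcases lt_or_gt_of_ne h3 with h4 | h4
    · exact disjoint_Ioo_of_le (row_separated hmin h4 h1 h2)
    · exact (disjoint_Ioo_of_le (row_separated (fun k hk => (hmin k hk).symm) h4 h2 h1)).symm
  push Not at hrow
  have hn : hgtLevel ω r = hgtLevel ω' r := by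
    refine firstLE_congr (exists_hgt_le ω hr) (exists_hgt_le ω' hr) fun n hn => ?_
    refine scaleProd_congr fun l hl => ?_
    have hl' := lt_min_iff.1 (hl.trans_le hn)
    rw [wordB, wordB, hrow l hl'.1 hl'.2]
  have hrow' : ∀ l < hgtLevel ω r, (ω l).1 = (ω' l).1 := fun l hl => hrow l hl (hn ▸ hl)
  by_cases hcol : ∃ l, l < widLevel ω r ∧ l < widLevel ω' r ∧ ω l ≠ ω' l
  · obtain ⟨h1, h2, h3⟩ := Nat.find_spec hcol
    have hmin : ∀ k < Nat.find hcol, ω k = ω' k := fun k hk => by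
      by_contra hne
      exact Nat.find_min hcol hk ⟨hk.trans h1, hk.trans h2, hne⟩
    refine Set.disjoint_prod.2 (.inl ?_)
    rcases column_gap (hrow' _ (h1.trans_le (widLevel_le_hgtLevel ω hr))) h3 with h4 | h4
    · exact disjoint_Ioo_of_le (column_separated hmin h4 h1 h2)
    · exact (disjoint_Ioo_of_le
        (column_separated (fun k hk => (hmin k hk).symm) h4 h2 h1)).symm
  push Not at hcol
  have hL : widLevel ω r = widLevel ω' r := by
    refine firstLE_congr (exists_wid_le ω hr) (exists_wid_le ω' hr) fun n hn => ?_
    refine scaleProd_congr fun l hl => ?_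
    have hl' := lt_min_iff.1 (hl.trans_le hn)
    rw [wordA, wordA, hcol l hl'.1 hl'.2]
  exact absurd ⟨fun l hl => (hcol l hl (hL ▸ hl)).symm, fun l hl => (hrow' l hl).symm⟩ h

/-! ### The coding map -/

/-- The point of the carpet coded by a word. -/
def code (ω : D.Word i) : ℝ × ℝ :=
  (limitPoint (wordA ω) (wordC ω), limitPoint (wordB ω) (wordD ω))

lemma code_mem_cell (ω : D.Word i) (L n : ℕ) : code ω ∈ cell ω L n :=
  ⟨limitPoint_mem (wordA_pos ω) (wordC_nonneg ω) (wordC_add ω) L,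
    limitPoint_mem (wordB_pos ω) (wordD_nonneg ω) (wordD_add ω) n⟩

lemma code_mem_planeCarpet (ω : D.Word i) : code ω ∈ planeCarpet D i :=
  ⟨ω, fun n => code_mem_cell ω n n⟩

lemma measurable_letter (l : ℕ) (f : D.Index (i l) → ℝ) :
    Measurable fun ω : D.Word i => f (ω l) :=
  (Measurable.of_discrete (f := f)).comp (measurable_pi_apply l)

lemma measurable_limitPoint {α : Type*} [MeasurableSpace α] {A C : α → ℕ → ℝ}
    (hA : ∀ l, Measurable fun ω => A ω l) (hC : ∀ l, Measurable fun ω => C ω l) :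
    Measurable fun ω => limitPoint (A ω) (C ω) := by
  unfold limitPoint
  refine Measurable.iSup fun n => ?_
  unfold offset scaleProd
  exact Finset.measurable_fun_sum _ fun l _ => (hC l).mul
    (Finset.measurable_fun_prod _ fun k _ => hA k)

lemma measurable_code : Measurable (code : D.Word i → ℝ × ℝ) :=
  (measurable_limitPoint (fun l => measurable_letter l fun w => D.a (i l) w.1 w.2)
    fun l => measurable_letter l fun w => D.c (i l) w.1 w.2).prodMk
  (measurable_limitPoint (fun l => measurable_letter l fun w => D.b (i l) w.1)
    fun l => measurable_letter l fun w => D.d (i l) w.1)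

/-! ### Counting cells by area -/

lemma volume_openCell (ω : D.Word i) (r : ℝ) : volume (openCell ω r)
    = ENNReal.ofReal (wid ω (widLevel ω r) * hgt ω (hgtLevel ω r)) := by
  rw [openCell, Measure.volume_eq_prod, Measure.prod_prod, Real.volume_Ioo, Real.volume_Ioo,
    ENNReal.ofReal_mul (wid_pos _ _).le]
  congr 2 <;> ring

/-- All these cells lie in a square of side `4 * r`, and each has area at least `(a₀ * r) ^ 2`. -/
lemma card_le_of_disjoint_openCell {a₀ : ℝ} (h0 : 0 < a₀) (h1 : a₀ ≤ 1)
    (ha : ∀ i j k, a₀ ≤ D.a i j k) {r : ℝ} (hr : 0 < r) (hr1 : r ≤ 1) {U : Set (ℝ × ℝ)}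
    (hU : ∀ x ∈ U, ∀ y ∈ U, dist x y ≤ r) (F : Finset (D.Word i)) (hF : ∀ ω ∈ F, code ω ∈ U)
    (hd : (F : Set (D.Word i)).PairwiseDisjoint fun ω => openCell ω r) :
    (F.card : ℝ) ≤ 16 / a₀ ^ 2 := by
  rcases F.eq_empty_or_nonempty with rfl | ⟨ω₀, hω₀⟩
  · simp; positivity
  set z := code ω₀ with hz
  have hsub : ∀ ω ∈ F, openCell ω r ⊆
      Icc (z.1 - 2 * r) (z.1 + 2 * r) ×ˢ Icc (z.2 - 2 * r) (z.2 + 2 * r) := by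
    intro ω hω y hy
    have hdist := hU _ (hF ω hω) _ (hF ω₀ hω₀)
    rw [← hz, Prod.dist_eq, max_le_iff, Real.dist_eq, Real.dist_eq, abs_le, abs_le] at hdist
    obtain ⟨⟨c1, c2⟩, c3, c4⟩ := code_mem_cell ω (widLevel ω r) (hgtLevel ω r)
    obtain ⟨⟨y1, y2⟩, y3, y4⟩ := hy
    have hw : wid ω (widLevel ω r) ≤ r := firstLE_spec (exists_wid_le ω hr)
    have hh : hgt ω (hgtLevel ω r) ≤ r := firstLE_spec (exists_hgt_le ω hr)
    refine ⟨⟨?_, ?_⟩, ?_, ?_⟩ <;> linarith [hdist.1.1, hdist.1.2, hdist.2.1, hdist.2.2]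
  have hvol : ∑ ω ∈ F, volume (openCell ω r) ≤ ENNReal.ofReal (4 * r * (4 * r)) := by
    rw [← measure_biUnion_finset hd fun ω _ => measurableSet_Ioo.prod measurableSet_Ioo]
    refine (measure_mono (Set.iUnion₂_subset hsub)).trans_eq ?_
    rw [Measure.volume_eq_prod, Measure.prod_prod, Real.volume_Icc, Real.volume_Icc,
      ENNReal.ofReal_mul (by positivity)]
    congr 2 <;> ring
  have hlow : ∀ ω ∈ F, ENNReal.ofReal (a₀ * r * (a₀ * r)) ≤ volume (openCell ω r) := by
    intro ω _
    rw [volume_openCell]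
    refine ENNReal.ofReal_le_ofReal (mul_le_mul ?_ ?_ (by positivity) (wid_pos _ _).le)
    · exact mul_le_scaleProd_firstLE h0 h1 (fun l => ha _ _ _) hr hr1
    · exact mul_le_scaleProd_firstLE h0 h1
        (fun l => (ha _ _ (ω l).2).trans (wordA_le ω l)) hr hr1
  have h := (Finset.card_nsmul_le_sum _ _ _ hlow).trans hvol
  rw [← ENNReal.ofReal_nsmul, ENNReal.ofReal_le_ofReal_iff (by positivity), nsmul_eq_mul] at h
  rw [le_div_iff₀ (by positivity)]
  have hr2 : 0 < r * r := by positivity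
  refine le_of_mul_le_mul_right ?_ hr2
  linarith

/-- Finitely many cells cover the words coding points of a small set. -/
lemma exists_finset_cover {a₀ : ℝ} (h0 : 0 < a₀) (h1 : a₀ ≤ 1)
    (ha : ∀ i j k, a₀ ≤ D.a i j k) {r : ℝ} (hr : 0 < r) (hr1 : r ≤ 1) {U : Set (ℝ × ℝ)}
    (hU : ∀ x ∈ U, ∀ y ∈ U, dist x y ≤ r) (E : Set (D.Word i)) :
    ∃ F : Finset (D.Word i), (F.card : ℝ) ≤ 16 / a₀ ^ 2 ∧ (∀ ω ∈ F, ω ∈ E) ∧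
      code ⁻¹' U ∩ E ⊆ ⋃ ω ∈ F, cylinder ω (widLevel ω r) (hgtLevel ω r) := by
  classical
  by_contra! hcon
  -- Greedy choice: any word left uncovered has an open cell disjoint from those chosen, so failure
  -- would give arbitrarily large disjoint families.
  have key : ∀ k : ℕ, ∃ F : Finset (D.Word i), F.card = k ∧ (∀ ω ∈ F, ω ∈ E) ∧
      (∀ ω ∈ F, code ω ∈ U) ∧
      (F : Set (D.Word i)).PairwiseDisjoint fun ω => openCell ω r := by
    intro k
    induction k with
    | zero => exact ⟨∅, by simp⟩
    | succ k ih =>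
      obtain ⟨F, hk, hE, hFU, hd⟩ := ih
      have hnot := hcon F (card_le_of_disjoint_openCell h0 h1 ha hr hr1 hU F hFU hd) hE
      obtain ⟨ω, ⟨hωU, hωE⟩, hω⟩ := Set.not_subset.1 hnot
      simp only [Set.mem_iUnion, not_exists] at hω
      have hωF : ω ∉ F := fun h => hω ω h ⟨fun _ _ => rfl, fun _ _ => rfl⟩
      refine ⟨insert ω F, by rw [Finset.card_insert_of_notMem hωF, hk], ?_, ?_, ?_⟩
      · exact Finset.forall_mem_insert _ _ _ |>.2 ⟨hωE, hE⟩
      · exact Finset.forall_mem_insert _ _ _ |>.2 ⟨hωU, hFU⟩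
      · rw [Finset.coe_insert, Set.pairwiseDisjoint_insert]
        exact ⟨hd, fun ω' hω' _ => (disjoint_openCell hr (hω ω' hω')).symm⟩
  obtain ⟨k, hk⟩ := exists_nat_gt (16 / a₀ ^ 2)
  obtain ⟨F, hFk, -, hFU, hd⟩ := key k
  have := card_le_of_disjoint_openCell h0 h1 ha hr hr1 hU F hFU hd
  rw [hFk] at this
  linarith

/-! ### The random product measures -/

/-- The mass of a letter: rows are distributed according to `P` given `x`, and the columns of a
row proportionally to `a ^ t`. -/
def letterMass (p : Fin m → ℝ) (P : (x : Fin m) → Fin (D.rows x) → ℝ) (t : ℝ) (x : Fin m)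
    (w : D.Index x) : ℝ :=
  P x w.1 / p x * (D.a x w.1 w.2 ^ t / D.rowSum t x w.1)

def letterMeasure (p : Fin m → ℝ) (P : (x : Fin m) → Fin (D.rows x) → ℝ) (t : ℝ) (x : Fin m) :
    Measure (D.Index x) :=
  ∑ w, ENNReal.ofReal (letterMass p P t x w) • Measure.dirac w

variable {p : Fin m → ℝ} {P : (x : Fin m) → Fin (D.rows x) → ℝ} {t : ℝ}

lemma letterMass_nonneg (hp : ∀ x, 0 < p x) (hP : D.Admissible p P) (x : Fin m)
    (w : D.Index x) : 0 ≤ letterMass p P t x w :=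
  mul_nonneg (div_nonneg (hP.1 _ _) (hp x).le)
    (div_nonneg (Real.rpow_nonneg (D.a_pos _ _ _).le _) (D.rowSum_pos _ _ _).le)

lemma sum_letterMass_row (x : Fin m) (j : Fin (D.rows x)) :
    ∑ k, letterMass p P t x ⟨j, k⟩ = P x j / p x := by
  simp only [letterMass, ← Finset.mul_sum, ← Finset.sum_div]
  rw [show ∑ k, D.a x j k ^ t = D.rowSum t x j from rfl, div_self (D.rowSum_pos t x j).ne', mul_one]

lemma sum_letterMass_mul (x : Fin m) (f : Fin (D.rows x) → ℝ) :
    ∑ w : D.Index x, letterMass p P t x w * f w.1 = ∑ j, P x j / p x * f j := by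
  rw [Fintype.sum_sigma]
  refine Finset.sum_congr rfl fun j _ => ?_
  simp only [← Finset.sum_mul, sum_letterMass_row]

lemma sum_letterMass (hp : ∀ x, 0 < p x) (hP : D.Admissible p P) (x : Fin m) :
    ∑ w : D.Index x, letterMass p P t x w = 1 := by
  have := sum_letterMass_mul (p := p) (P := P) (t := t) x fun _ => 1
  simp only [mul_one] at this
  rw [this, ← Finset.sum_div, hP.2 x, div_self (hp x).ne']

lemma isProbabilityMeasure_letterMeasure (hp : ∀ x, 0 < p x) (hP : D.Admissible p P)
    (x : Fin m) : IsProbabilityMeasure (letterMeasure p P t x) :=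
  isProbabilityMeasure_sum_dirac (letterMass_nonneg hp hP x) (sum_letterMass hp hP x)

lemma letterMeasure_singleton (x : Fin m) (w : D.Index x) :
    letterMeasure p P t x {w} = ENNReal.ofReal (letterMass p P t x w) := by
  simp only [letterMeasure, Measure.finsetSum_apply, Measure.smul_apply, smul_eq_mul,
    Measure.dirac_apply, Set.indicator_apply, Set.mem_singleton_iff, Pi.one_apply, mul_ite,
    mul_one, mul_zero]
  simp

lemma letterMeasure_row (hp : ∀ x, 0 < p x) (hP : D.Admissible p P) (x : Fin m)
    (j : Fin (D.rows x)) :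
    letterMeasure p P t x {w | w.1 = j} = ENNReal.ofReal (P x j / p x) := by
  simp only [letterMeasure, Measure.finsetSum_apply, Measure.smul_apply, smul_eq_mul,
    Measure.dirac_apply, Set.indicator_apply, Set.mem_ofPred_eq, Pi.one_apply, mul_ite,
    mul_one, mul_zero]
  rw [Fintype.sum_sigma, Finset.sum_eq_single_of_mem j (Finset.mem_univ _)]
  · simp only [if_true]
    rw [← ENNReal.ofReal_sum_of_nonneg fun k _ => letterMass_nonneg hp hP x _,
      sum_letterMass_row]
  · intro j' _ hj'
    simp [hj']

/-- The product measure on words. -/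
def wordMeasure (p : Fin m → ℝ) (P : (x : Fin m) → Fin (D.rows x) → ℝ) (t : ℝ)
    (i : ℕ → Fin m) : Measure (D.Word i) :=
  Measure.infinitePi fun l => letterMeasure p P t (i l)

lemma wordMeasure_cylinder (hp : ∀ x, 0 < p x) (hP : D.Admissible p P) (ω : D.Word i) {L n : ℕ}
    (h : L ≤ n) : wordMeasure p P t i (cylinder ω L n)
      = ENNReal.ofReal ((∏ l ∈ Finset.range n, P (i l) (ω l).1 / p (i l)) *
        (wid ω L ^ t / ∏ l ∈ Finset.range L, D.rowSum t (i l) (ω l).1)) := by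
  have : ∀ l, IsProbabilityMeasure (letterMeasure p P t (i l)) := fun l =>
    isProbabilityMeasure_letterMeasure hp hP _
  have e : cylinder ω L n = Set.pi (Finset.range n)
      fun l => if l < L then {ω l} else {w | w.1 = (ω l).1} := by
    ext ω'
    simp only [cylinder, Set.mem_ofPred_eq, Set.mem_pi, Finset.coe_range, Set.mem_Iio]
    constructor
    · rintro ⟨h1, h2⟩ l hl
      split_ifs with hL
      · exact h1 l hL
      · exact h2 l hl
    · intro h1
      refine ⟨fun l hl => ?_, fun l hl => ?_⟩
      · have := h1 l (hl.trans_le h)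
        rwa [if_pos hl] at this
      · have := h1 l hl
        split_ifs at this with hL
        · rw [Set.mem_singleton_iff.1 this]
        · exact this
  rw [e, wordMeasure, Measure.infinitePi_pi _ fun l _ => MeasurableSet.of_discrete]
  have e2 : ∀ l, letterMeasure p P t (i l) (if l < L then {ω l} else {w | w.1 = (ω l).1})
      = ENNReal.ofReal (P (i l) (ω l).1 / p (i l) *
        if l < L then wordA ω l ^ t / D.rowSum t (i l) (ω l).1 else 1) := by
    intro l
    split_ifs with hL
    · rw [letterMeasure_singleton]; rfl
    · rw [letterMeasure_row hp hP, mul_one]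
  simp only [e2]
  rw [← ENNReal.ofReal_prod_of_nonneg]
  · rw [prod_mul_ite_lt ω (fun x j => P x j / p x) t h]
  · intro l _
    refine mul_nonneg (div_nonneg (hP.1 _ _) (hp _).le) ?_
    split_ifs
    · exact div_nonneg (Real.rpow_nonneg (wordA_pos ω l).le _) (D.rowSum_pos _ _ _).le
    · exact zero_le_one

/-- Row functions of mean zero have vanishing averages along almost every word. -/
lemma ae_tendsto_row_average (hp : ∀ x, 0 < p x) (hP : D.Admissible p P)
    (hi : ∀ x, Tendsto (fun n : ℕ => (letterCount i x n : ℝ) / n) atTop (𝓝 (p x)))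
    (f : (x : Fin m) → Fin (D.rows x) → ℝ) (hf : ∑ x, ∑ j, P x j * f x j = 0) :
    ∀ᵐ ω ∂(wordMeasure p P t i), Tendsto (fun n : ℕ =>
      (∑ l ∈ Finset.range n, f (i l) (ω l).1) / n) atTop (𝓝 0) := by
  have : ∀ l, IsProbabilityMeasure (letterMeasure p P t (i l)) := fun l =>
    isProbabilityMeasure_letterMeasure hp hP _
  obtain ⟨M, -, hM⟩ := exists_abs_bound (ι := Σ x, Fin (D.rows x)) fun y => f y.1 y.2
  have key := ae_tendsto_average (μ := fun l => letterMeasure p P t (i l))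
    (f := fun l w => f (i l) w.1) (fun l => Measurable.of_discrete) (M := M)
    fun l w => hM ⟨i l, w.1⟩
  have hint : ∀ l, ∫ w, f (i l) w.1 ∂(letterMeasure p P t (i l))
      = ∑ j, P (i l) j / p (i l) * f (i l) j := fun l => by
    rw [letterMeasure, integral_sum_dirac (letterMass_nonneg hp hP _), sum_letterMass_mul]
  -- Individual letters need not have mean zero; only the average over the limiting frequencies `p`
  -- vanishes.
  have hmean : Tendsto (fun n : ℕ => (∑ l ∈ Finset.range n,
      ∑ j, P (i l) j / p (i l) * f (i l) j) / n) atTop (𝓝 0) := by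
    have e : ∀ n : ℕ, (∑ l ∈ Finset.range n, ∑ j, P (i l) j / p (i l) * f (i l) j) / n
        = ∑ x, (letterCount i x n : ℝ) / n * ∑ j, P x j / p x * f x j := by
      intro n
      rw [sum_range_eq_sum_letterCount i n fun x => ∑ j, P x j / p x * f x j, Finset.sum_div]
      exact Finset.sum_congr rfl fun x _ => by ring
    have e0 : (0 : ℝ) = ∑ x, p x * ∑ j, P x j / p x * f x j := by
      rw [← hf]
      refine Finset.sum_congr rfl fun x _ => ?_
      rw [Finset.mul_sum]
      refine Finset.sum_congr rfl fun j _ => ?_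
      have := (hp x).ne'
      field_simp
    simp only [e]
    rw [e0]
    exact tendsto_finsetSum _ fun x _ => (hi x).mul_const _
  filter_upwards [key] with ω hω
  have := hω.add hmean
  rw [zero_add] at this
  refine this.congr fun n => ?_
  simp only [hint, Finset.sum_sub_distrib]
  ring

/-- The words along which the sums of `f` and `g` are controlled from the index `N` on. -/
def controlledWords (i : ℕ → Fin m) (f g : (x : Fin m) → Fin (D.rows x) → ℝ) (κ : ℝ) (N : ℕ) :
    Set (D.Word i) :=
  {ω | ∀ n ≥ N, ∑ l ∈ Finset.range n, f (i l) (ω l).1 ≤ κ * n ∧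
    -(κ * n) ≤ ∑ l ∈ Finset.range n, g (i l) (ω l).1}

lemma measurableSet_controlledWords (f g : (x : Fin m) → Fin (D.rows x) → ℝ) (κ : ℝ) (N : ℕ) :
    MeasurableSet (controlledWords i f g κ N) := by
  have hm : ∀ (f : (x : Fin m) → Fin (D.rows x) → ℝ) (n : ℕ),
      Measurable fun ω : D.Word i => ∑ l ∈ Finset.range n, f (i l) (ω l).1 := fun f n =>
    Finset.measurable_fun_sum _ fun l _ => measurable_letter l fun w => f (i l) w.1
  have : controlledWords i f g κ N = ⋂ n ≥ N,
      {ω : D.Word i | ∑ l ∈ Finset.range n, f (i l) (ω l).1 ≤ κ * n} ∩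
      {ω : D.Word i | -(κ * n) ≤ ∑ l ∈ Finset.range n, g (i l) (ω l).1} := by
    ext ω; simp [controlledWords]
  rw [this]
  exact MeasurableSet.iInter fun n => MeasurableSet.iInter fun _ =>
    (measurableSet_le (hm f n) measurable_const).inter (measurableSet_le measurable_const (hm g n))

/-- Almost every word is controlled from some index on, so one of countably many sets has positive
mass; this makes the estimates uniform. -/
lemma exists_controlledWords_pos (hp : ∀ x, 0 < p x) (hP : D.Admissible p P)
    (hi : ∀ x, Tendsto (fun n : ℕ => (letterCount i x n : ℝ) / n) atTop (𝓝 (p x)))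
    (f g : (x : Fin m) → Fin (D.rows x) → ℝ) (hf : ∑ x, ∑ j, P x j * f x j = 0)
    (hg : ∑ x, ∑ j, P x j * g x j = 0) {κ : ℝ} (hκ : 0 < κ) :
    ∃ N, wordMeasure p P t i (controlledWords i f g κ N) ≠ 0 := by
  have : ∀ l, IsProbabilityMeasure (letterMeasure p P t (i l)) := fun l =>
    isProbabilityMeasure_letterMeasure hp hP _
  have : IsProbabilityMeasure (wordMeasure p P t i) := by unfold wordMeasure; infer_instance
  by_contra! hcon
  have h0 : wordMeasure p P t i (⋃ N, controlledWords i f g κ N) = 0 := measure_iUnion_null hcon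
  have h1 : ∀ᵐ ω ∂(wordMeasure p P t i), ω ∈ ⋃ N, controlledWords i f g κ N := by
    filter_upwards [ae_tendsto_row_average hp hP hi f hf,
      ae_tendsto_row_average hp hP hi g hg] with ω h1 h2
    have e := ((h1.eventually_lt_const hκ).and
      (h2.eventually_const_lt (neg_lt_zero.2 hκ))).and (eventually_gt_atTop 0)
    obtain ⟨N, hN⟩ := eventually_atTop.1 e
    refine Set.mem_iUnion.2 ⟨N, fun n hn => ?_⟩
    obtain ⟨⟨a1, a2⟩, a3⟩ := hN n hn
    have a3' : (0 : ℝ) < n := by exact_mod_cast a3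
    rw [div_lt_iff₀ a3'] at a1
    rw [lt_div_iff₀ a3'] at a2
    exact ⟨a1.le, by linarith⟩
  have h2 : wordMeasure p P t i univ = 0 := by
    refine measure_mono_null (fun ω _ => ?_) (measure_union_null h0 h1)
    by_cases h : ω ∈ ⋃ N, controlledWords i f g κ N
    · exact .inl h
    · exact .inr h
  simp at h2

/-- As `log B < 0`, this bounds `hgtLevel` above by `1 + log r / log B`, turning errors `κ * n` into
small powers of `r`. -/
lemma hgtLevel_mul_log_ge {B : ℝ} (hB0 : 0 < B) (hB1 : B < 1) (hB : ∀ i j, D.b i j ≤ B)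
    (ω : D.Word i) {r : ℝ} (hr : 0 < r) (hr1 : r ≤ 1) :
    Real.log r + Real.log B ≤ hgtLevel ω r * Real.log B := by
  have hlB : Real.log B < 0 := Real.log_neg hB0 hB1
  have hlr : Real.log r ≤ 0 := Real.log_nonpos hr.le hr1
  rcases Nat.eq_zero_or_pos (hgtLevel ω r) with h | h
  · rw [h]; simp; linarith
  · obtain ⟨k, hk⟩ := Nat.exists_eq_succ_of_ne_zero h.ne'
    have h1 : r < hgt ω k := lt_of_lt_firstLE (by rw [hgtLevel] at hk; omega)
    have h2 : hgt ω k ≤ B ^ k := scaleProd_le_pow (wordB_pos ω) (fun l => hB _ _) k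
    have h3 : Real.log r ≤ k * Real.log B := by
      rw [← Real.log_pow]
      exact Real.log_le_log hr (h1.le.trans h2)
    rw [hk]
    push_cast
    linarith

lemma le_widLevel {a₀ : ℝ} (h0 : 0 < a₀) (h1 : a₀ ≤ 1) (ha : ∀ i j k, a₀ ≤ D.a i j k)
    (ω : D.Word i) {r : ℝ} (hr : 0 < r) {N : ℕ} (hN : r < a₀ ^ N) : N ≤ widLevel ω r := by
  by_contra! h
  have e1 : wid ω (widLevel ω r) ≤ r := firstLE_spec (exists_wid_le ω hr)
  have e2 : a₀ ^ widLevel ω r ≤ wid ω (widLevel ω r) :=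
    pow_le_scaleProd h0.le (fun l => ha _ _ _) _
  have e3 : a₀ ^ N ≤ a₀ ^ widLevel ω r := pow_le_pow_of_le_one h0.le h1 h.le
  linarith

/-- Control of the first function bounds the row factor by `hgt ^ dim * exp (κ n)`, control of the
second bounds the inverse row sums by `exp (κ L)`, and `wid ^ t ≤ r ^ t`. The correction `2 * κ /
log B` is negative and tends to `0` with `κ`. -/
lemma wordMeasure_cylinder_le (hp : ∀ x, 0 < p x) (hP : D.Admissible p P) (ht : 0 ≤ t)
    {dim : ℝ} (hdim : 0 ≤ dim) {a₀ : ℝ} (h0 : 0 < a₀) (h1 : a₀ ≤ 1)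
    (ha : ∀ i j k, a₀ ≤ D.a i j k) {B : ℝ} (hB0 : 0 < B) (hB1 : B < 1)
    (hB : ∀ i j, D.b i j ≤ B) {κ : ℝ} (hκ : 0 < κ) {N : ℕ} {ω : D.Word i}
    (hω : ω ∈ controlledWords i
      (fun x j => Real.log (P x j / p x) - dim * Real.log (D.b x j))
      (fun x j => Real.log (D.rowSum t x j)) κ N)
    {r : ℝ} (hr : 0 < r) (hr1 : r ≤ 1) (hrN : r < a₀ ^ N) :
    wordMeasure p P t i (cylinder ω (widLevel ω r) (hgtLevel ω r))
      ≤ ENNReal.ofReal (Real.exp (2 * κ) * r ^ (dim + t + 2 * κ / Real.log B)) := by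
  have hlB : Real.log B < 0 := Real.log_neg hB0 hB1
  have hLn := widLevel_le_hgtLevel ω hr
  have hNL := le_widLevel h0 h1 ha ω hr hrN
  rw [wordMeasure_cylinder hp hP ω hLn]
  refine ENNReal.ofReal_le_ofReal ?_
  have hn := hgtLevel_mul_log_ge hB0 hB1 hB ω hr hr1
  have hw : wid ω (widLevel ω r) ≤ r := firstLE_spec (exists_wid_le ω hr)
  have hh : hgt ω (hgtLevel ω r) ≤ r := firstLE_spec (exists_hgt_le ω hr)
  set L := widLevel ω r
  set n := hgtLevel ω r
  have hf := (hω n (hNL.trans hLn)).1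
  have hg := (hω L hNL).2
  simp only [Finset.sum_sub_distrib, ← Finset.mul_sum] at hf
  change _ - dim * ∑ l ∈ Finset.range n, Real.log (wordB ω l) ≤ _ at hf
  rw [← log_hgt] at hf
  -- Only an inequality, since `P` may vanish and `exp (log 0) = 1`.
  have e1 : ∏ l ∈ Finset.range n, P (i l) (ω l).1 / p (i l)
      ≤ Real.exp (∑ l ∈ Finset.range n, Real.log (P (i l) (ω l).1 / p (i l))) := by
    rw [Real.exp_sum]
    exact Finset.prod_le_prod (fun l _ => div_nonneg (hP.1 _ _) (hp _).le)
      fun l _ => Real.le_exp_log _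
  have e2 : ∏ l ∈ Finset.range L, D.rowSum t (i l) (ω l).1
      = Real.exp (∑ l ∈ Finset.range L, Real.log (D.rowSum t (i l) (ω l).1)) := by
    rw [Real.exp_sum]
    exact Finset.prod_congr rfl fun l _ => (Real.exp_log (D.rowSum_pos _ _ _)).symm
  rw [e2, Real.rpow_def_of_pos (wid_pos ω L), ← Real.exp_sub, Real.rpow_def_of_pos hr,
    ← Real.exp_add]
  refine (mul_le_mul_of_nonneg_right e1 (Real.exp_pos _).le).trans ?_
  rw [← Real.exp_add, Real.exp_le_exp]
  have f1 : Real.log (wid ω L) * t ≤ Real.log r * t :=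
    mul_le_mul_of_nonneg_right (Real.log_le_log (wid_pos ω L) hw) ht
  have f2 : dim * Real.log (hgt ω n) ≤ dim * Real.log r :=
    mul_le_mul_of_nonneg_left (Real.log_le_log (hgt_pos ω n) hh) hdim
  have f3 : (n : ℝ) ≤ 1 + Real.log r / Real.log B := by
    rw [← sub_le_iff_le_add', le_div_iff_of_neg hlB]
    linarith
  have f4 : κ * L ≤ κ * n := mul_le_mul_of_nonneg_left (by exact_mod_cast hLn) hκ.le
  have f5 : 2 * κ * n ≤ 2 * κ * (1 + Real.log r / Real.log B) :=
    mul_le_mul_of_nonneg_left f3 (by positivity)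
  have f6 : Real.log r * (dim + t + 2 * κ / Real.log B)
      = dim * Real.log r + Real.log r * t + 2 * κ * (Real.log r / Real.log B) := by ring
  rw [f6]
  linarith

end CarpetFamily

/-- The mass distribution principle, for measures controlled on sets of small diameter. -/
lemma hausdorffMeasure_ne_zero_of_le {X : Type*} [MetricSpace X] [MeasurableSpace X]
    [BorelSpace X] (μ : Measure X) {s C r₀ : ℝ} (hs : 0 < s) (hC : 0 < C) (hr₀ : 0 < r₀)
    (h : ∀ (U : Set X) (r : ℝ), 0 < r → r < r₀ → MeasurableSet U →
      (∀ x ∈ U, ∀ y ∈ U, dist x y ≤ r) → μ U ≤ ENNReal.ofReal (C * r ^ s))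
    {A : Set X} (hA : μ A ≠ 0) : μH[s] A ≠ 0 := by
  have key : ∀ U : Set X, Metric.ediam U ≤ ENNReal.ofReal (r₀ / 2) →
      (ENNReal.ofReal C)⁻¹ * μ U ≤ Metric.ediam U ^ s := by
    intro U hU
    have hfin : Metric.ediam U ≠ ⊤ := ne_top_of_le_ne_top ENNReal.ofReal_ne_top hU
    set d := (Metric.ediam U).toReal with hd
    have hd0 : 0 ≤ d := ENNReal.toReal_nonneg
    have hdr : d < r₀ := by
      have : d ≤ r₀ / 2 := by
        rw [hd]
        exact ENNReal.toReal_le_of_le_ofReal (by positivity) hU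
      linarith
    -- Radii strictly above `d`, followed by a limit, also cover diameter `0`; the closure supplies
    -- measurability without increasing the diameter.
    have h1 : ∀ r, d < r → r < r₀ → μ U ≤ ENNReal.ofReal (C * r ^ s) := by
      intro r hr hr'
      refine (measure_mono subset_closure).trans
        (h _ r (hd0.trans_lt hr) hr' isClosed_closure.measurableSet fun x hx y hy => ?_)
      have : edist x y ≤ Metric.ediam U := by
        rw [← Metric.ediam_closure U]; exact Metric.edist_le_ediam_of_mem hx hy
      rw [dist_edist]
      exact (ENNReal.toReal_mono hfin this).trans hr.le
    have hcont : Tendsto (fun r : ℝ => ENNReal.ofReal (C * r ^ s)) (𝓝[>] d)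
        (𝓝 (ENNReal.ofReal (C * d ^ s))) := by
      have : ContinuousAt (fun r : ℝ => ENNReal.ofReal (C * r ^ s)) d :=
        ENNReal.continuous_ofReal.continuousAt.comp
          (continuousAt_const.mul (Real.continuousAt_rpow_const _ _ (.inr hs.le)))
      exact this.tendsto.mono_left nhdsWithin_le_nhds
    have h2 : μ U ≤ ENNReal.ofReal (C * d ^ s) := by
      refine ge_of_tendsto hcont ?_
      filter_upwards [Ioo_mem_nhdsGT hdr] with r hr using h1 r hr.1 hr.2
    rw [ENNReal.ofReal_mul hC.le, ← ENNReal.ofReal_rpow_of_nonneg hd0 hs.le, hd,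
      ENNReal.ofReal_toReal hfin] at h2
    rw [mul_comm, ← div_eq_mul_inv]
    exact ENNReal.div_le_of_le_mul' h2
  have hle := Measure.le_hausdorffMeasure s ((ENNReal.ofReal C)⁻¹ • μ) (ENNReal.ofReal (r₀ / 2))
    (by simp [hr₀]) key
  intro h0
  have := (hle A).trans_eq h0
  rw [Measure.smul_apply, smul_eq_mul, nonpos_iff_eq_zero, mul_eq_zero] at this
  rcases this with h' | h'
  · exact ENNReal.ofReal_ne_top (ENNReal.inv_eq_zero.1 h')
  · exact hA h'

/-! ### Lower bound by mass distribution, and the dimension formula. -/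

namespace CarpetFamily

variable {m : ℕ} {D : CarpetFamily m} {i : ℕ → Fin m}

variable {p : Fin m → ℝ} {P : (x : Fin m) → Fin (D.rows x) → ℝ} {t : ℝ}

lemma le_dimH_planeCarpet (hp : ∀ x, 0 < p x) (hp1 : ∑ x, p x = 1)
    (hi : ∀ x, Tendsto (fun n : ℕ => (letterCount i x n : ℝ) / n) atTop (𝓝 (p x)))
    (hP : D.Admissible p P) (ht : D.IsFiberDim P t) :
    ENNReal.ofReal (D.baseDim p P + t) ≤ dimH (planeCarpet D i) := by
  obtain ⟨B, hB0, hB1, hB⟩ := D.exists_b_bound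
  obtain ⟨a₀, ha0, ha1, ha⟩ := D.exists_a_bound
  have hlB : Real.log B < 0 := Real.log_neg hB0 hB1
  have hdim := hP.baseDim_nonneg hp hp1
  set dim := D.baseDim p P with hdimdef
  suffices h : ∀ κ > 0, ENNReal.ofReal (dim + t + 2 * κ / Real.log B)
      ≤ dimH (planeCarpet D i) by
    have hc : Tendsto (fun κ : ℝ => ENNReal.ofReal (dim + t + 2 * κ / Real.log B)) (𝓝[>] 0)
        (𝓝 (ENNReal.ofReal (dim + t))) := by
      have : Continuous fun κ : ℝ => ENNReal.ofReal (dim + t + 2 * κ / Real.log B) :=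
        ENNReal.continuous_ofReal.comp (by fun_prop)
      simpa using (this.tendsto 0).mono_left nhdsWithin_le_nhds
    exact le_of_tendsto hc (eventually_mem_nhdsWithin.mono fun κ hκ => h κ hκ)
  intro κ hκ
  set s := dim + t + 2 * κ / Real.log B with hs
  rcases le_or_gt s 0 with hs0 | hs0
  · rw [ENNReal.ofReal_of_nonpos hs0]; exact zero_le
  set f : (x : Fin m) → Fin (D.rows x) → ℝ :=
    fun x j => Real.log (P x j / p x) - dim * Real.log (D.b x j) with hf
  set g : (x : Fin m) → Fin (D.rows x) → ℝ := fun x j => Real.log (D.rowSum t x j) with hg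
  -- The value `λ(P)` is exactly the one giving `f` mean zero; `g` has mean zero because `t` is the
  -- zero of the pressure.
  have hf0 : ∑ x, ∑ j, P x j * f x j = 0 := by
    have h := hP.baseDim_mul hp hp1
    simp only [hf, mul_sub, Finset.sum_sub_distrib, ← h, hdimdef, Finset.mul_sum]
    rw [sub_eq_zero]
    exact Finset.sum_congr rfl fun x _ => Finset.sum_congr rfl fun j _ => by ring
  obtain ⟨N, hN⟩ := exists_controlledWords_pos (t := t) hp hP hi f g hf0 ht.2 hκ
  set E := controlledWords i f g κ N with hE
  have hEm : MeasurableSet E := measurableSet_controlledWords f g κ N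
  set μ := ((wordMeasure p P t i).restrict E).map code with hμ
  have hpos : μ (planeCarpet D i) ≠ 0 := by
    -- This inequality needs no measurability of the carpet.
    have h1 := Measure.le_map_apply (μ := (wordMeasure p P t i).restrict E)
      measurable_code.aemeasurable (planeCarpet D i)
    have h2 : code ⁻¹' planeCarpet D i = (univ : Set (D.Word i)) :=
      Set.eq_univ_of_forall code_mem_planeCarpet
    rw [h2, Measure.restrict_apply_univ] at h1
    exact fun h0 => hN (nonpos_iff_eq_zero.1 (h1.trans_eq h0))
  have hH := hausdorffMeasure_ne_zero_of_le μ (s := s) (C := 16 / a₀ ^ 2 * Real.exp (2 * κ))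
    (r₀ := a₀ ^ N) hs0 (by positivity) (by positivity) ?_ hpos
  · have hs' : s = ((s.toNNReal : NNReal) : ℝ) := (Real.coe_toNNReal s hs0.le).symm
    rw [hs'] at hH
    exact le_dimH_of_hausdorffMeasure_ne_zero hH
  intro U r hr hrN hU hdist
  have hr1 : r ≤ 1 := hrN.le.trans (pow_le_one₀ ha0.le ha1)
  obtain ⟨F, hFc, hFE, hcov⟩ := exists_finset_cover ha0 ha1 ha hr hr1 hdist E
  rw [hμ, Measure.map_apply measurable_code hU, Measure.restrict_apply (measurable_code hU)]
  refine (measure_mono hcov).trans ((measure_biUnion_finset_le _ _).trans ?_)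
  refine (Finset.sum_le_sum fun ω hω => wordMeasure_cylinder_le hp hP ht.1.1 hdim ha0 ha1 ha
    hB0 hB1 hB hκ (hFE ω hω) hr hr1 hrN).trans ?_
  rw [Finset.sum_const, ← ENNReal.ofReal_nsmul, nsmul_eq_mul, mul_assoc]
  exact ENNReal.ofReal_le_ofReal (mul_le_mul_of_nonneg_right hFc (by positivity))

lemma dimH_carpet_eq (hp : ∀ x, 0 < p x) (hp1 : ∑ x, p x = 1)
    (hi : ∀ x, Tendsto (fun n : ℕ => (letterCount i x n : ℝ) / n) atTop (𝓝 (p x)))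
    {s : ℝ} (hs : IsLUB (D.dimValues p) s) : dimH (D.carpet i) = ENNReal.ofReal s := by
  rw [dimH_carpet]
  have hle := dimH_planeCarpet_le hp hp1 hi hs.1
  refine le_antisymm hle ?_
  have hfin : dimH (planeCarpet D i) ≠ ⊤ := ne_top_of_le_ne_top ENNReal.ofReal_ne_top hle
  refine ENNReal.ofReal_le_of_le_toReal (hs.2 ?_)
  rintro _ ⟨P, t, hP, ht, rfl⟩
  exact (ENNReal.ofReal_le_iff_le_toReal hfin).1 (le_dimH_planeCarpet hp hp1 hi hP ht)

end CarpetFamily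

end

theorem theoremA :
    ∃ ε : ℝ, 0 < ε ∧
      ∀ (m : ℕ) (p : Fin m → ℝ), (∀ i, 0 < p i) → ∑ i, p i = 1 →
      ∀ D : CarpetFamily m, D.Generic → (D.NearlyUniform ε ∨ D.NearlyConformal ε) →
        (∀ P : (i : Fin m) → Fin (D.rows i) → ℝ, D.Admissible p P →
          ∃! t : ℝ, D.IsFiberDim P t) ∧
        ∃ s : ℝ, IsLUB (D.dimValues p) s ∧
          ∀ᵐ i ∂(bernoulliMeasure p), dimH (D.carpet i) = ENNReal.ofReal s := by
  refine ⟨1, one_pos, fun m p hp hp1 D _ _ => ⟨fun P hP => ?_, ?_⟩⟩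
  · exact CarpetFamily.existsUnique_isFiberDim hP.1 (by rw [hP.sum_eq, hp1]; exact one_pos)
  · have hs := isLUB_csSup (CarpetFamily.nonempty_dimValues hp)
      (CarpetFamily.bddAbove_dimValues (D := D) hp hp1)
    refine ⟨_, hs, ?_⟩
    filter_upwards [ae_bernoulli_frequency hp hp1] with i hi
    exact CarpetFamily.dimH_carpet_eq hp hp1 hi hs
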